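/- **Proposition.** Let $K$ be a non-archimedean local field with its canonical absolute value $|\cdot|$ (the modulus of the additive Haar measure), ring of integers $O=\{|x|\le 1\}$, prime ideal $P=\{|x|<1\}$, uniformizer $\beta$ (so $P=\beta O$), $q=\#(O/P)$, and let $S\subset O$ be a complete set of representatives of $O/P$ with $0\in S$. Put $B_r=\beta^{-r}O$ for $r\in\mathbf Z$, and let $\chi$ be a continuous unitary character of $(K,+)$ of rank zero, i.e. $0$ is the largest integer $r$ with $\chi|_{B_r}\equiv 1$. Let $\alpha>0$ and $t>0$, and let $v:K\to[0,\infty)$ be continuous with $v(x)\to\infty$ as $|x|\to\infty$. For each integer $n\ge 1$ let $X_n=\{\sum_{i=-n}^{n-1}a_i\beta^i : a_i\in S\}$ and, for $s\ge 0$, $$p_{s,n}(x)=q^{-n}\sum_{\xi\in X_n}e^{-s|\xi|^\alpha}\chi(x\xi).$$ Let $D[0,t]$ be the space of functions $\omega:[0,t]\to K$ that are right-continuous with left limits and left-continuous at $t$, with the $\sigma$-algebra generated by the coordinate maps $\omega\mapsto\omega(s)$. For every $n\ge1$ and $a\in X_n$ there is a unique probability measure $\mathbf P^n_a$ on $D[0,t]$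 such that $$\mathbf P^n_a(\omega(t_i)\in J_i,\ 1\le i\le N)=\sum_{b_i\in J_i\cap X_n,\ 1\le i\le N}\ \prod_{i=1}^N p_{t_i-t_{i-1},n}(b_i-b_{i-1})\,q^{-n}\qquad(t_0=0,\ b_0=a)$$ for all $0\le t_1<\dots<t_N\le t$ and all Borel sets $J_1,\dots,J_N\subset K$. Let $\mathbf P^n_{a,b,t}$ denote $\mathbf P^n_a$ conditioned on the event $\omega(t)=b$, and set $$K^n_t(x,y)=p_{t,n}(y-x)\int_{D[0,t]}e^{-\int_0^t v(\omega(s))\,ds}\,d\mathbf P^n_{x,y,t}(\omega),\qquad x,y\in X_n .$$ Then for every real $k$ with $0<k<\alpha$ there is a constant $A_k>0$, independent of $n$ and $x$, such that for all $n\ge1$ and all $x\in X_n\setminus\{0\}$ $$K^n_t(x,x)\le A_k\left(e^{-\frac t2 v^*(x)}+\frac1{|x|^k}\right),\qquad v^*(x)=\inf_{|y|=|x|}v(y).$$ -/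

import Mathlib

open MeasureTheory Filter Topology Set

noncomputable section

namespace LocalFieldPropagator

section LocalField

variable (K : Type*) [NontriviallyNormedField K] [MeasurableSpace K]

/-- The norm of `K` is the canonical absolute value, i.e. the modulus of the additive Haar measure:
multiplication by `a` scales every Haar measure by the factor `‖a‖`. -/
def IsCanonicalAbs : Prop :=
  ∀ (μ : Measure K) [μ.IsAddHaarMeasure] (a : K) (E : Set K), MeasurableSet E →
    μ ((fun x => a * x) '' E) = ENNReal.ofReal ‖a‖ * μ E

variable {K}

/-- `β` generates the prime ideal `P = {x | ‖x‖ < 1}` of `O = {x | ‖x‖ ≤ 1}`. -/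
def IsUniformizer (β : K) : Prop :=
  {x : K | ‖x‖ < 1} = (fun y => β * y) '' {y : K | ‖y‖ ≤ 1}

/-- `S ⊆ O` is a complete set of representatives of the residue classes in `O / P`, in which the
zero class is represented by `0`. In particular `S.card` is the number `q` of elements
of `O / P`. -/
structure IsDigitSet (S : Finset K) : Prop where
  zero_mem : (0 : K) ∈ S
  norm_le_one : ∀ s ∈ S, ‖s‖ ≤ 1
  existsUnique_rep : ∀ x : K, ‖x‖ ≤ 1 → ∃! s, s ∈ S ∧ ‖x - s‖ < 1

/-- The ball `B_r = β⁻ʳ O`, `r ∈ ℤ`. -/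
def ball (β : K) (r : ℤ) : Set K := (fun y => β ^ (-r) * y) '' {y : K | ‖y‖ ≤ 1}

/-- A continuous unitary character of `(K, +)` of rank zero: `0` is the largest integer `r`
such that the character is trivial on `B_r`. -/
def IsRankZeroCharacter (β : K) (χ : AddChar K Circle) : Prop :=
  Continuous χ ∧ IsGreatest {r : ℤ | ∀ x ∈ ball β r, χ x = 1} 0

open Classical in
/-- The canonical set of representatives `X_n` of `G_n = B_n / B_{-n}`: all sums
`∑ a_i β^i`, `-n ≤ i ≤ n - 1`, with digits `a_i ∈ S`. -/
def grid (S : Finset K) (β : K) (n : ℕ) : Finset K :=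
  Finset.univ.image fun a : Fin (2 * n) → S => ∑ i, (a i : K) * β ^ ((i : ℤ) - (n : ℤ))

/-- The inverse finite Fourier transform
`(𝓕_n⁻¹ f)(x) = q⁻ⁿ ∑_{ξ ∈ X_n} f(ξ) χ(x ξ)`. -/
def finiteFourierInv (S : Finset K) (β : K) (χ : AddChar K Circle) (n : ℕ) (f : K → ℂ) (x : K) :
    ℂ :=
  ((S.card : ℂ) ^ n)⁻¹ * ∑ ξ ∈ grid S β n, f ξ * (χ (x * ξ) : ℂ)

/-- The density `p_{s,n} = 𝓕_n⁻¹ (e^{-s|·|^α})`. The transform is real-valued because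
`e^{-s|·|^α}` is even on the group `X_n`; `re` only changes the type. As a function on `B_n` it is
invariant under `B_{-n}`, so that differences of points of `X_n` may be taken in `K`. -/
def density (S : Finset K) (β : K) (χ : AddChar K Circle) (α : ℝ) (n : ℕ) (s : ℝ) (x : K) : ℝ :=
  (finiteFourierInv S β χ n (fun ξ => (Real.exp (-s * ‖ξ‖ ^ α) : ℂ)) x).re

end LocalField

section Paths

variable {K : Type*} [NontriviallyNormedField K]

/-- Skorokhod functions on `[0,t]`: right-continuous with left limits, and left-continuous at the
end point `t`. -/
structure IsSkorokhod {t : ℝ} (ω : Icc (0 : ℝ) t → K) : Prop where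
  right_cont : ∀ s, Tendsto ω (𝓝[>] s) (𝓝 (ω s))
  left_lim : ∀ s, ∃ l, Tendsto ω (𝓝[<] s) (𝓝 l)
  left_cont_end : ∀ s : Icc (0 : ℝ) t, (s : ℝ) = t → Tendsto ω (𝓝[<] s) (𝓝 (ω s))

variable (K) in
/-- The path space `D[0,t]`. As a subtype of `[0,t] → K` it carries the σ-algebra generated by the
coordinates `ω ↦ ω(s)`. -/
abbrev SkorokhodSpace (t : ℝ) : Type _ := {ω : Icc (0 : ℝ) t → K // IsSkorokhod ω}

variable [MeasurableSpace K]

open Classical in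
/-- `P` is the probability measure `𝐏ⁿ_a` on `D[0,t]`: for `0 ≤ t_1 < ⋯ < t_N ≤ t` and Borel sets
`J_1, …, J_N`,
`P(ω(t_i) ∈ J_i) = ∑_{b_i ∈ J_i ∩ X_n} ∏_i p_{t_i - t_{i-1}, n}(b_i - b_{i-1}) q⁻ⁿ`,
where `t_0 = 0` and `b_0 = a`. -/
def IsPathMeasure (S : Finset K) (β : K) (χ : AddChar K Circle) (α : ℝ) (n : ℕ) (t : ℝ) (a : K)
    (P : Measure (SkorokhodSpace K t)) : Prop :=
  IsProbabilityMeasure P ∧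
    ∀ (N : ℕ) (τ : Fin N → Icc (0 : ℝ) t) (J : Fin N → Set K), StrictMono τ →
      (∀ i, MeasurableSet (J i)) →
      P.real {ω | ∀ i, ω.1 (τ i) ∈ J i} =
        ∑ b ∈ Fintype.piFinset (fun i => (grid S β n).filter (· ∈ J i)),
          ∏ i : Fin N,
            density S β χ α n
              ((τ i : ℝ) - (Fin.cons 0 (fun j => (τ j : ℝ)) : Fin (N + 1) → ℝ) i.castSucc)
              (b i - (Fin.cons a b : Fin (N + 1) → K) i.castSucc) *
            ((S.card : ℝ) ^ n)⁻¹

/-- The measure `𝐏ⁿ_a` on `D[0,t]`, determined by its finite-dimensional distributions. -/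
def pathMeasure (S : Finset K) (β : K) (χ : AddChar K Circle) (α : ℝ) (n : ℕ) (t : ℝ) (a : K) :
    Measure (SkorokhodSpace K t) :=
  Classical.epsilon (IsPathMeasure S β χ α n t a)

/-- The conditioned measure `𝐏ⁿ_{a,b,t}(A) = 𝐏ⁿ_a(A ∩ (ω(t) = b)) / 𝐏ⁿ_a(ω(t) = b)`. -/
def bridgeMeasure (S : Finset K) (β : K) (χ : AddChar K Circle) (α : ℝ) (n : ℕ) {t : ℝ}
    (ht : 0 < t) (a b : K) : Measure (SkorokhodSpace K t) :=
  ProbabilityTheory.cond (pathMeasure S β χ α n t a) {ω | ω.1 ⟨t, ht.le, le_rfl⟩ = b}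

/-- The propagator
`Kⁿ_t(x,y) = (∫_{D[0,t]} e^{-∫_0^t v(ω(s)) ds} d𝐏ⁿ_{x,y,t}(ω)) · p_{t,n}(y - x)`. -/
def propagator (S : Finset K) (β : K) (χ : AddChar K Circle) (α : ℝ) (v : K → ℝ) (n : ℕ) {t : ℝ}
    (ht : 0 < t) (x y : K) : ℝ :=
  (∫ ω, Real.exp (-∫ s in (0 : ℝ)..t, v (ω.1 (projIcc 0 t ht.le s))) ∂(bridgeMeasure S β χ α n ht x y)) *
    density S β χ α n t (y - x)

/-- `v*(x) = inf_{|y| = |x|} v(y)`. -/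
def sphereInf (v : K → ℝ) (x : K) : ℝ := sInf (v '' {y | ‖y‖ = ‖x‖})

end Paths

end LocalFieldPropagator

end

/-! Write `q` for `S.card`. The event `ω(t) = x` has mass `p_t(0) q⁻ⁿ` under `𝐏ⁿ_x`, so the
propagator on the diagonal is `qⁿ` times the integral of `exp (-∫ v(ω(s)) ds)` over loops at `x`
(`propagator_self_eq`). By Jensen the integrand is at most the average over `s ∈ (0,t)` of `exp (-t
v(ω(s)))`, and Fubini reduces the estimate to one fixed time `s`.

At that time there are two kinds of loops. If `‖ω(s) - x‖ < ‖x‖`, the ultrametric inequality forces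
`‖ω(s)‖ = ‖x‖`, hence `v(ω(s)) ≥ v*(x)`. The far loops have mass `q⁻²ⁿ ∑ p_s(y-x) p_{t-s}(x-y)` over
distant `y`. One of `s`, `t-s` is at least `t/2`; the corresponding density is at most
`p_{t/2,n}(0)`, and the other is summed by a tail estimate. This yields `C (exp (-t v*(x)) + t
‖β‖^(-α) ‖x‖^(-α))` when `‖x‖ ≥ 1`, which is stronger than required; for `‖x‖ < 1` the term
`1/‖x‖^k` exceeds 1 and `p_{t,n}(0) ≤ C` suffices.

Fourier analysis on the finite group `B_n / B_{-n}` supplies the bounds: radially decreasing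
functions have nonnegative transforms (`sum_antitone_nonneg`), the tail outside a ball is linear in
time (`sum_density_tail_le`), and `p_{t/2,n}(0)` is bounded uniformly in `n`
(`exists_density_zero_le`).

The path measure is realised as a compound Poisson process. Its jump rates have transform `Λ -
‖ξ‖^α`, with `Λ = jumpRate β α n`, and are nonnegative by the same positivity result; the
exponential series then produces `exp (-s ‖ξ‖^α)`. -/

noncomputable section

namespace LocalFieldPropagator

/-! ### Digit expansions and the grid as a set of representatives of `B_n / B_{-n}`. -/

section Grid

variable {K : Type*} [NontriviallyNormedField K] {β : K} {S : Finset K}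

lemma IsUniformizer.norm_lt_one (hβ : IsUniformizer β) : ‖β‖ < 1 := by
  have h : β ∈ {x : K | ‖x‖ < 1} := by
    rw [hβ]; exact ⟨1, by simp, by simp⟩
  exact h

lemma IsUniformizer.ne_zero (hβ : IsUniformizer β) : β ≠ 0 := by
  rintro rfl
  obtain ⟨x, hx0, hx1⟩ := NormedField.exists_norm_lt_one K
  have h : x ∈ {x : K | ‖x‖ < 1} := hx1
  rw [hβ] at h
  obtain ⟨y, -, hy⟩ := h
  simp at hy
  simp [← hy] at hx0

lemma IsUniformizer.norm_pos (hβ : IsUniformizer β) : 0 < ‖β‖ := norm_pos_iff.2 hβ.ne_zero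

lemma IsUniformizer.norm_le_norm (hβ : IsUniformizer β) {x : K} (hx : ‖x‖ < 1) : ‖x‖ ≤ ‖β‖ := by
  have h : x ∈ {x : K | ‖x‖ < 1} := hx
  rw [hβ] at h
  obtain ⟨y, hy, rfl⟩ := h
  simpa using mul_le_of_le_one_right (norm_nonneg β) hy

/-- The norm takes no value strictly between consecutive powers of `‖β‖`: if `‖β‖ ^ (-r) ≤ ‖x‖ < ‖β‖
^ (-(r+1))`, then `x β ^ (r+1)` lies in `P`, so its norm is at most `‖β‖`. -/
lemma IsUniformizer.exists_norm_eq (hβ : IsUniformizer β) {x : K} (hx : x ≠ 0) :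
    ∃ r : ℤ, ‖x‖ = ‖β‖ ^ (-r) := by
  obtain ⟨r, h1, h2⟩ := exists_mem_Ico_zpow (norm_pos_iff.2 hx)
    ((one_lt_inv₀ hβ.norm_pos).2 hβ.norm_lt_one)
  have hp := hβ.norm_pos
  refine ⟨r, le_antisymm ?_ (by simpa using h1)⟩
  have h3 : ‖x * β ^ (r + 1)‖ < 1 := by
    rw [norm_mul, norm_zpow]
    rw [inv_zpow, lt_inv_comm₀ (norm_pos_iff.2 hx) (zpow_pos hp _)] at h2
    have := mul_lt_mul_of_pos_left h2 (norm_pos_iff.2 hx)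
    rwa [mul_inv_cancel₀ (norm_ne_zero_iff.2 hx)] at this
  have h4 := hβ.norm_le_norm h3
  rw [norm_mul, norm_zpow, zpow_add₀ hp.ne', zpow_one, ← mul_assoc] at h4
  have h5 : ‖x‖ * ‖β‖ ^ r ≤ 1 := by
    by_contra! h
    nlinarith
  rw [zpow_neg, ← one_div]
  exact (le_div_iff₀ (zpow_pos hp _)).2 h5

lemma IsUniformizer.zpow_le_zpow_iff (hβ : IsUniformizer β) {r s : ℤ} :
    ‖β‖ ^ (-r) ≤ ‖β‖ ^ (-s) ↔ r ≤ s := by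
  rw [zpow_le_zpow_iff_right_of_lt_one₀ hβ.norm_pos hβ.norm_lt_one]; omega

lemma IsUniformizer.mem_ball_iff (hβ : IsUniformizer β) {r : ℤ} {x : K} :
    x ∈ ball β r ↔ ‖x‖ ≤ ‖β‖ ^ (-r) := by
  have hp : 0 < ‖β‖ ^ (-r) := zpow_pos hβ.norm_pos _
  constructor
  · rintro ⟨y, hy, rfl⟩
    simpa only [norm_mul, norm_zpow] using mul_le_of_le_one_right hp.le hy
  · intro h
    refine ⟨β ^ r * x, ?_, ?_⟩
    · simp only [mem_ofPred_eq, norm_mul, norm_zpow]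
      rw [zpow_neg] at h
      exact (le_inv_mul_iff₀ (zpow_pos hβ.norm_pos r)).1 (by simpa using h)
    · simp only [← mul_assoc]
      rw [← zpow_add₀ hβ.ne_zero]; simp

lemma IsDigitSet.zero_mem_grid (hS : IsDigitSet S) (n : ℕ) : (0 : K) ∈ grid S β n := by
  classical
  simp only [grid, Finset.mem_image, Finset.mem_univ, true_and]
  exact ⟨fun _ => ⟨0, hS.zero_mem⟩, by simp⟩

variable [IsUltrametricDist K]

lemma norm_add_le_of_le {x y : K} {c : ℝ} (hx : ‖x‖ ≤ c) (hy : ‖y‖ ≤ c) : ‖x + y‖ ≤ c :=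
  (IsUltrametricDist.norm_add_le_max x y).trans (max_le hx hy)

lemma norm_sub_le_of_le {x y : K} {c : ℝ} (hx : ‖x‖ ≤ c) (hy : ‖y‖ ≤ c) : ‖x - y‖ ≤ c :=
  sub_eq_add_neg x y ▸ norm_add_le_of_le hx (by rwa [norm_neg])

/-- The residue class of `x` forces the zeroth digit, since all later terms lie in `P`. Subtracting
that digit and dividing by `β` leaves an integral element, to which the induction hypothesis
applies. -/
lemma IsUniformizer.existsUnique_digits (hβ : IsUniformizer β) (hS : IsDigitSet S) (l : ℕ) :
    ∀ x : K, ‖x‖ ≤ 1 → ∃! a : Fin l → S, ‖x - ∑ i, (a i : K) * β ^ (i : ℕ)‖ ≤ ‖β‖ ^ l := by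
  have hp := hβ.norm_pos
  induction l with
  | zero =>
    intro x hx
    exact ⟨fun i => i.elim0, by simpa using hx, fun a _ => funext fun i => i.elim0⟩
  | succ l ih =>
    intro x hx
    have key : ∀ (s : K) (a : Fin l → S), x - (s + ∑ i, (a i : K) * β ^ ((i : ℕ) + 1)) =
        β * (β⁻¹ * (x - s) - ∑ i, (a i : K) * β ^ (i : ℕ)) := by
      intro s a
      rw [mul_sub, mul_inv_cancel_left₀ hβ.ne_zero, Finset.mul_sum, ← sub_sub]
      congr 1
      exact Finset.sum_congr rfl fun i _ => by ring
    have hle : ∀ a : Fin l → S, ‖∑ i, (a i : K) * β ^ ((i : ℕ) + 1)‖ ≤ ‖β‖ := by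
      intro a
      refine IsUltrametricDist.norm_sum_le_of_forall_le_of_nonneg hp.le fun i _ => ?_
      rw [norm_mul, norm_pow, pow_succ, ← mul_assoc]
      refine mul_le_of_le_one_left hp.le (mul_le_one₀ (hS.norm_le_one _ (a i).2) (by positivity) ?_)
      exact pow_le_one₀ hp.le hβ.norm_lt_one.le
    obtain ⟨s, ⟨hs, hxs⟩, hsu⟩ := hS.existsUnique_rep x hx
    have hy : ‖β⁻¹ * (x - s)‖ ≤ 1 := by
      rw [norm_mul, norm_inv, inv_mul_le_iff₀ hp, mul_one]
      exact hβ.norm_le_norm hxs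
    obtain ⟨a, ha, hau⟩ := ih _ hy
    refine ⟨Fin.cons ⟨s, hs⟩ a, ?_, ?_⟩
    · simp only [Fin.sum_univ_succ, Fin.cons_zero, Fin.cons_succ, Fin.val_zero, pow_zero, mul_one,
        Fin.val_succ]
      rw [key, norm_mul, pow_succ']
      exact mul_le_mul_of_nonneg_left ha hp.le
    · intro a' ha'
      obtain ⟨s', c, rfl⟩ : ∃ s' c, a' = Fin.cons s' c := ⟨_, _, (Fin.cons_self_tail a').symm⟩
      simp only [Fin.sum_univ_succ, Fin.cons_zero, Fin.cons_succ, Fin.val_zero, pow_zero, mul_one,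
        Fin.val_succ] at ha'
      have h1 : s' = ⟨s, hs⟩ := by
        refine Subtype.ext (hsu s' ⟨s'.2, ?_⟩)
        refine lt_of_le_of_lt ?_ hβ.norm_lt_one
        have : x - (s' : K) = (x - (s' + ∑ i, (c i : K) * β ^ ((i : ℕ) + 1))) +
          ∑ i, (c i : K) * β ^ ((i : ℕ) + 1) := by ring
        rw [this]
        refine norm_add_le_of_le (ha'.trans ?_) (hle c)
        rw [pow_succ']
        exact mul_le_of_le_one_right hp.le (pow_le_one₀ hp.le hβ.norm_lt_one.le)
      subst h1
      rw [key, norm_mul, pow_succ', mul_le_mul_iff_right₀ hp] at ha'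
      rw [hau c ha']

lemma IsUniformizer.existsUnique_digits_grid (hβ : IsUniformizer β) (hS : IsDigitSet S) (n : ℕ)
    {x : K} (hx : ‖x‖ ≤ ‖β‖ ^ (-(n : ℤ))) :
    ∃! a : Fin (2 * n) → S, ‖x - ∑ i, (a i : K) * β ^ ((i : ℤ) - (n : ℤ))‖ ≤ ‖β‖ ^ (n : ℤ) := by
  have hp := hβ.norm_pos
  have hx' : ‖β ^ n * x‖ ≤ 1 := by
    rw [norm_mul, norm_pow]
    rw [zpow_neg, zpow_natCast] at hx
    exact (le_inv_mul_iff₀ (pow_pos hp n)).1 (by simpa using hx)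
  convert hβ.existsUnique_digits hS (2 * n) _ hx' using 2 with a
  have : β ^ n * x - ∑ i, (a i : K) * β ^ (i : ℕ) =
      β ^ n * (x - ∑ i, (a i : K) * β ^ ((i : ℤ) - (n : ℤ))) := by
    rw [mul_sub, Finset.mul_sum]
    congr 1
    refine Finset.sum_congr rfl fun i _ => ?_
    rw [zpow_sub₀ hβ.ne_zero, zpow_natCast, zpow_natCast]
    field_simp [hβ.ne_zero]
  have h2 : ‖β‖ ^ (2 * n) = ‖β‖ ^ n * ‖β‖ ^ n := by rw [two_mul, pow_add]
  rw [this, norm_mul, norm_pow, h2, zpow_natCast, mul_le_mul_iff_right₀ (pow_pos hp n)]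

lemma IsUniformizer.norm_le_of_mem_grid (hβ : IsUniformizer β) (hS : IsDigitSet S) {n : ℕ} {x : K}
    (hx : x ∈ grid S β n) : ‖x‖ ≤ ‖β‖ ^ (-(n : ℤ)) := by
  classical
  simp only [grid, Finset.mem_image, Finset.mem_univ, true_and] at hx
  obtain ⟨a, rfl⟩ := hx
  refine IsUltrametricDist.norm_sum_le_of_forall_le_of_nonneg
    (zpow_pos hβ.norm_pos _).le fun i _ => ?_
  rw [norm_mul, norm_zpow]
  refine (mul_le_of_le_one_left (zpow_pos hβ.norm_pos _).le (hS.norm_le_one _ (a i).2)).trans ?_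
  exact zpow_le_zpow_right_of_le_one₀ hβ.norm_pos hβ.norm_lt_one.le (by omega)

lemma IsUniformizer.eq_of_mem_grid (hβ : IsUniformizer β) (hS : IsDigitSet S) {n : ℕ} {x y : K}
    (hx : x ∈ grid S β n) (hy : y ∈ grid S β n) (h : ‖x - y‖ ≤ ‖β‖ ^ (n : ℤ)) : x = y := by
  classical
  have hx' := hβ.norm_le_of_mem_grid hS hx
  simp only [grid, Finset.mem_image, Finset.mem_univ, true_and] at hx hy
  obtain ⟨a, rfl⟩ := hx
  obtain ⟨c, rfl⟩ := hy
  have := (hβ.existsUnique_digits_grid hS n hx').unique (y₁ := a) (y₂ := c)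
    (by rw [sub_self, norm_zero]; exact (zpow_pos hβ.norm_pos _).le) h
  rw [this]

lemma IsUniformizer.card_grid (hβ : IsUniformizer β) (hS : IsDigitSet S) (n : ℕ) :
    (grid S β n).card = S.card ^ (2 * n) := by
  classical
  rw [grid, Finset.card_image_of_injective, Finset.card_univ]
  · simp
  · intro a c h
    dsimp only at h
    have hx' : ‖∑ i, (a i : K) * β ^ ((i : ℤ) - (n : ℤ))‖ ≤ ‖β‖ ^ (-(n : ℤ)) :=
      hβ.norm_le_of_mem_grid hS (Finset.mem_image_of_mem _ (Finset.mem_univ a))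
    exact (hβ.existsUnique_digits_grid hS n hx').unique
      (by rw [sub_self, norm_zero]; exact (zpow_pos hβ.norm_pos _).le)
      (by rw [h, sub_self, norm_zero]; exact (zpow_pos hβ.norm_pos _).le)

/-- The representative in `grid S β n` of the class of `x` modulo `ball β (-n)`. -/
def gridRep (S : Finset K) (β : K) (n : ℕ) (x : K) : K :=
  Classical.epsilon fun ξ => ξ ∈ grid S β n ∧ ‖x - ξ‖ ≤ ‖β‖ ^ (n : ℤ)

lemma IsUniformizer.gridRep_spec (hβ : IsUniformizer β) (hS : IsDigitSet S) {n : ℕ} {x : K}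
    (hx : ‖x‖ ≤ ‖β‖ ^ (-(n : ℤ))) :
    gridRep S β n x ∈ grid S β n ∧ ‖x - gridRep S β n x‖ ≤ ‖β‖ ^ (n : ℤ) := by
  classical
  obtain ⟨a, ha, -⟩ := hβ.existsUnique_digits_grid hS n hx
  exact Classical.epsilon_spec (p := fun ξ => ξ ∈ grid S β n ∧ ‖x - ξ‖ ≤ ‖β‖ ^ (n : ℤ))
    ⟨_, Finset.mem_image_of_mem _ (Finset.mem_univ a), ha⟩

lemma IsUniformizer.gridRep_eq_iff (hβ : IsUniformizer β) (hS : IsDigitSet S) {n : ℕ} {x y : K}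
    (hx : ‖x‖ ≤ ‖β‖ ^ (-(n : ℤ))) (hy : y ∈ grid S β n) :
    gridRep S β n x = y ↔ ‖x - y‖ ≤ ‖β‖ ^ (n : ℤ) := by
  obtain ⟨h1, h2⟩ := hβ.gridRep_spec hS hx
  refine ⟨fun h => h ▸ h2, fun h => hβ.eq_of_mem_grid hS h1 hy ?_⟩
  have : gridRep S β n x - y = (x - y) - (x - gridRep S β n x) := by ring
  rw [this]
  exact norm_sub_le_of_le h h2

/-- Sums over the grid of functions invariant under `ball β (-n)` are translation invariant. -/
lemma IsUniformizer.sum_grid_add (hβ : IsUniformizer β) (hS : IsDigitSet S) {n : ℕ}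
    {M : Type*} [AddCommMonoid M] (f : K → M)
    (hf : ∀ z w : K, ‖z‖ ≤ ‖β‖ ^ (-(n : ℤ)) → ‖w‖ ≤ ‖β‖ ^ (n : ℤ) → f (z + w) = f z)
    {h : K} (hh : ‖h‖ ≤ ‖β‖ ^ (-(n : ℤ))) :
    ∑ ξ ∈ grid S β n, f (ξ + h) = ∑ ξ ∈ grid S β n, f ξ := by
  have hb : ∀ ξ ∈ grid S β n, ‖ξ + h‖ ≤ ‖β‖ ^ (-(n : ℤ)) := fun ξ hξ =>
    norm_add_le_of_le (hβ.norm_le_of_mem_grid hS hξ) hh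
  have hmaps : Set.MapsTo (fun ξ => gridRep S β n (ξ + h)) (grid S β n) (grid S β n) :=
    fun ξ hξ => (hβ.gridRep_spec hS (hb ξ hξ)).1
  have hinj : Set.InjOn (fun ξ => gridRep S β n (ξ + h)) (grid S β n) := by
    intro ξ hξ η hη heq
    have h1 := (hβ.gridRep_spec hS (hb ξ hξ)).2
    have h2 := (hβ.gridRep_spec hS (hb η hη)).2
    dsimp only at heq
    rw [heq] at h1
    refine hβ.eq_of_mem_grid hS hξ hη ?_
    have : ξ - η = (ξ + h - gridRep S β n (η + h)) - (η + h - gridRep S β n (η + h)) := by ring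
    rw [this]
    exact norm_sub_le_of_le h1 h2
  -- Translation followed by reduction is an injection of the finite grid into itself, hence a
  -- permutation.
  refine Finset.sum_nbij (fun ξ => gridRep S β n (ξ + h)) hmaps hinj
    (Finset.surjOn_of_injOn_of_card_le _ hmaps hinj le_rfl) fun ξ hξ => ?_
  obtain ⟨h1, h2⟩ := hβ.gridRep_spec hS (hb ξ hξ)
  have := hf (gridRep S β n (ξ + h)) (ξ + h - gridRep S β n (ξ + h))
    (hβ.norm_le_of_mem_grid hS h1) h2
  rw [← this]
  congr 1
  ring

end Grid

/-! ### Orthogonality of characters, duality of balls, positivity of transforms. -/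

section Characters

variable {K : Type*} [NontriviallyNormedField K] {β : K} {S : Finset K} {χ : AddChar K Circle}

/-- The points of `grid S β n` in `ball β r`. -/
def ballGrid (S : Finset K) (β : K) (n : ℕ) (r : ℤ) : Finset K :=
  (grid S β n).filter fun ξ => ‖ξ‖ ≤ ‖β‖ ^ (-r)

lemma mem_ballGrid {n : ℕ} {r : ℤ} {ξ : K} :
    ξ ∈ ballGrid S β n r ↔ ξ ∈ grid S β n ∧ ‖ξ‖ ≤ ‖β‖ ^ (-r) := by
  simp [ballGrid]

lemma IsDigitSet.card_pos (hS : IsDigitSet S) : 0 < S.card := Finset.card_pos.2 ⟨0, hS.zero_mem⟩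

lemma IsRankZeroCharacter.eq_one (hβ : IsUniformizer β) (hχ : IsRankZeroCharacter β χ) {x : K}
    (hx : ‖x‖ ≤ 1) : χ x = 1 :=
  hχ.2.1 x (hβ.mem_ball_iff.2 (by simpa using hx))

lemma IsRankZeroCharacter.exists_ne_one (hβ : IsUniformizer β) (hχ : IsRankZeroCharacter β χ) :
    ∃ x : K, ‖x‖ ≤ ‖β‖ ^ (-1 : ℤ) ∧ χ x ≠ 1 := by
  by_contra! h
  have := hχ.2.2 (show (1 : ℤ) ∈ {r : ℤ | ∀ x ∈ ball β r, χ x = 1} from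
    fun x hx => h x (hβ.mem_ball_iff.1 hx))
  omega

/-- `χ (z * ·)` is invariant under `ball β (-n)` for `z ∈ ball β n`. -/
lemma IsRankZeroCharacter.map_mul_add (hβ : IsUniformizer β) (hχ : IsRankZeroCharacter β χ) {n : ℕ}
    {z x w : K} (hz : ‖z‖ ≤ ‖β‖ ^ (-(n : ℤ))) (hw : ‖w‖ ≤ ‖β‖ ^ (n : ℤ)) :
    χ (z * (x + w)) = χ (z * x) := by
  rw [mul_add, AddChar.map_add_eq_mul, hχ.eq_one hβ (x := z * w), mul_one]
  rw [norm_mul]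
  calc ‖z‖ * ‖w‖ ≤ ‖β‖ ^ (-(n : ℤ)) * ‖β‖ ^ (n : ℤ) := by gcongr
    _ = 1 := by rw [← zpow_add₀ hβ.norm_pos.ne']; simp

variable [IsUltrametricDist K]

lemma IsUniformizer.ballGrid_self (hβ : IsUniformizer β) (hS : IsDigitSet S) (n : ℕ) :
    ballGrid S β n n = grid S β n :=
  Finset.filter_true_of_mem fun _ hξ => hβ.norm_le_of_mem_grid hS hξ

lemma IsUniformizer.ballGrid_neg (hβ : IsUniformizer β) (hS : IsDigitSet S) (n : ℕ) :
    ballGrid S β n (-n) = {0} := by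
  ext ξ
  rw [mem_ballGrid, Finset.mem_singleton, neg_neg]
  constructor
  · rintro ⟨h1, h2⟩
    exact hβ.eq_of_mem_grid hS h1 (hS.zero_mem_grid n) (by simpa using h2)
  · rintro rfl
    exact ⟨hS.zero_mem_grid n, by simp⟩

lemma norm_add_le_iff {x y : K} {c : ℝ} (hy : ‖y‖ ≤ c) : ‖x + y‖ ≤ c ↔ ‖x‖ ≤ c := by
  refine ⟨fun h => ?_, fun h => norm_add_le_of_le h hy⟩
  simpa using norm_sub_le_of_le h hy

/-- Since `-n ≤ r`, the ball is a union of cosets of `ball β (-n)`, and it is stable under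
translation by `h`. Thus `f` cut off to the ball is still invariant and `sum_grid_add` applies. -/
lemma IsUniformizer.sum_ballGrid_add (hβ : IsUniformizer β) (hS : IsDigitSet S) {n : ℕ} {r : ℤ}
    (hr : -(n : ℤ) ≤ r) (hrn : r ≤ n)
    {M : Type*} [AddCommMonoid M] (f : K → M)
    (hf : ∀ z w : K, ‖z‖ ≤ ‖β‖ ^ (-(n : ℤ)) → ‖w‖ ≤ ‖β‖ ^ (n : ℤ) → f (z + w) = f z)
    {h : K} (hh : ‖h‖ ≤ ‖β‖ ^ (-r)) :
    ∑ ξ ∈ ballGrid S β n r, f (ξ + h) = ∑ ξ ∈ ballGrid S β n r, f ξ := by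
  have h1 := hβ.sum_grid_add hS (n := n) (fun z => if ‖z‖ ≤ ‖β‖ ^ (-r) then f z else 0) (h := h) ?_
    (hh.trans (hβ.zpow_le_zpow_iff.2 hrn))
  · rw [ballGrid, Finset.sum_filter, Finset.sum_filter, ← h1]
    exact Finset.sum_congr rfl fun ξ _ => by simp only [norm_add_le_iff hh]
  · intro z w hz hw
    have hw' : ‖w‖ ≤ ‖β‖ ^ (-r) :=
      hw.trans (by simpa using hβ.zpow_le_zpow_iff.2 hr)
    simp only [norm_add_le_iff hw', hf z w hz hw]

/-- Orthogonality of characters on the group of classes of `ball β r` modulo `ball β (-n)`. -/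
lemma IsRankZeroCharacter.sum_ballGrid (hβ : IsUniformizer β) (hS : IsDigitSet S)
    (hχ : IsRankZeroCharacter β χ) {n : ℕ} {r : ℤ} (hr : -(n : ℤ) ≤ r) (hrn : r ≤ n) {z : K}
    (hz : ‖z‖ ≤ ‖β‖ ^ (-(n : ℤ))) :
    ∑ ξ ∈ ballGrid S β n r, (χ (z * ξ) : ℂ) =
      if ‖z‖ ≤ ‖β‖ ^ r then ((ballGrid S β n r).card : ℂ) else 0 := by
  split_ifs with h
  · rw [Finset.sum_congr rfl (g := fun _ => (1 : ℂ))]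
    · simp
    · intro ξ hξ
      rw [hχ.eq_one hβ]
      · simp
      · rw [norm_mul]
        calc ‖z‖ * ‖ξ‖ ≤ ‖β‖ ^ r * ‖β‖ ^ (-r) := by
              gcongr
              exact (mem_ballGrid.1 hξ).2
          _ = 1 := by rw [← zpow_add₀ hβ.norm_pos.ne']; simp
  · have hz0 : z ≠ 0 := by
      rintro rfl
      exact h (by simpa using (zpow_pos hβ.norm_pos r).le)
    obtain ⟨m, hm⟩ := hβ.exists_norm_eq hz0
    obtain ⟨x, hx, hx1⟩ := hχ.exists_ne_one hβ
    have hrm : 1 - m ≤ r := by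
      by_contra! hlt
      exact h (by rw [hm]; exact zpow_le_zpow_right_of_le_one₀ hβ.norm_pos hβ.norm_lt_one.le (by omega))
    -- Translation by `x / z` preserves the ball and multiplies the sum by `χ x ≠ 1`, so the sum
    -- vanishes.
    have hh : ‖x / z‖ ≤ ‖β‖ ^ (-r) := by
      rw [norm_div, hm, div_le_iff₀ (zpow_pos hβ.norm_pos _), ← zpow_add₀ hβ.norm_pos.ne']
      exact hx.trans (zpow_le_zpow_right_of_le_one₀ hβ.norm_pos hβ.norm_lt_one.le (by omega))
    have key := hβ.sum_ballGrid_add hS hr hrn (fun ξ => (χ (z * ξ) : ℂ))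
      (fun y w _ hw => by simp only [hχ.map_mul_add hβ hz hw]) hh
    simp only [mul_add, AddChar.map_add_eq_mul, Circle.coe_mul, ← Finset.sum_mul,
      mul_div_cancel₀ x hz0] at key
    by_contra h0
    exact hx1 (Circle.ext (by simpa using mul_left_cancel₀ h0 (key.trans (mul_one _).symm)))

lemma IsRankZeroCharacter.sum_grid (hβ : IsUniformizer β) (hS : IsDigitSet S)
    (hχ : IsRankZeroCharacter β χ) {n : ℕ} {z : K} (hz : ‖z‖ ≤ ‖β‖ ^ (-(n : ℤ))) :
    ∑ ξ ∈ grid S β n, (χ (z * ξ) : ℂ) =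
      if ‖z‖ ≤ ‖β‖ ^ (n : ℤ) then (S.card : ℂ) ^ (2 * n) else 0 := by
  have := hχ.sum_ballGrid hβ hS (n := n) (r := n) (by omega) le_rfl hz
  rw [hβ.ballGrid_self hS, hβ.card_grid hS] at this
  exact_mod_cast this

/-- The balls `B_r` and `B_{-r}` are dual. The double sum of `χ (z ξ)` over `z` in the grid and `ξ`
in the ball is evaluated in both orders: summing over `ξ` first leaves `z ∈ B_{-r}`, summing over
`z` first leaves only `ξ = 0`. -/
lemma IsRankZeroCharacter.card_ballGrid_mul (hβ : IsUniformizer β) (hS : IsDigitSet S)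
    (hχ : IsRankZeroCharacter β χ) {n : ℕ} {r : ℤ} (hr : -(n : ℤ) ≤ r) (hrn : r ≤ n) :
    (ballGrid S β n r).card * (ballGrid S β n (-r)).card = S.card ^ (2 * n) := by
  classical
  have h1 : ∑ z ∈ grid S β n, ∑ ξ ∈ ballGrid S β n r, (χ (z * ξ) : ℂ) =
      (ballGrid S β n r).card * (ballGrid S β n (-r)).card := by
    rw [Finset.sum_congr rfl fun z hz =>
      hχ.sum_ballGrid hβ hS hr hrn (hβ.norm_le_of_mem_grid hS hz), ← Finset.sum_filter]
    rw [Finset.sum_const, nsmul_eq_mul, mul_comm, ballGrid, ballGrid, neg_neg]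
  rw [Finset.sum_comm] at h1
  have h2 : ∀ ξ ∈ ballGrid S β n r, ∑ z ∈ grid S β n, (χ (z * ξ) : ℂ) =
      if ξ = 0 then (S.card : ℂ) ^ (2 * n) else 0 := by
    intro ξ hξ
    have hξ' := (mem_ballGrid.1 hξ).1
    simp_rw [mul_comm _ ξ]
    rw [hχ.sum_grid hβ hS (hβ.norm_le_of_mem_grid hS hξ')]
    refine if_congr ⟨fun h => ?_, ?_⟩ rfl rfl
    · exact hβ.eq_of_mem_grid hS hξ' (hS.zero_mem_grid n) (by simpa using h)
    · rintro rfl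
      simp
  rw [Finset.sum_congr rfl h2, Finset.sum_ite_eq', if_pos] at h1
  · exact_mod_cast h1.symm
  · exact mem_ballGrid.2 ⟨hS.zero_mem_grid n, by simpa using (zpow_pos hβ.norm_pos r).le⟩

/-- The leading digit splits the larger ball into at most `S.card` classes; subtracting that digit
and reducing to the grid injects each class into the smaller ball. -/
lemma IsUniformizer.card_ballGrid_succ_le (hβ : IsUniformizer β) (hS : IsDigitSet S) {n : ℕ} {r : ℤ}
    (hr : -(n : ℤ) ≤ r) (hrn : r + 1 ≤ n) :
    (ballGrid S β n (r + 1)).card ≤ S.card * (ballGrid S β n r).card := by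
  classical
  have hp := hβ.norm_pos
  have hdig : ∀ ξ ∈ ballGrid S β n (r + 1), ∃ s ∈ S, ‖ξ - s * β ^ (-(r + 1))‖ ≤ ‖β‖ ^ (-r) := by
    intro ξ hξ
    have h1 : ‖ξ * β ^ (r + 1)‖ ≤ 1 := by
      rw [norm_mul, norm_zpow]
      calc _ ≤ ‖β‖ ^ (-(r + 1)) * ‖β‖ ^ (r + 1) := by
            gcongr
            exact (mem_ballGrid.1 hξ).2
        _ = 1 := by rw [← zpow_add₀ hp.ne']; simp
    obtain ⟨s, ⟨hs, hs1⟩, -⟩ := hS.existsUnique_rep _ h1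
    refine ⟨s, hs, ?_⟩
    have h2 : ξ - s * β ^ (-(r + 1)) = (ξ * β ^ (r + 1) - s) * β ^ (-(r + 1)) := by
      rw [sub_mul, mul_assoc, ← zpow_add₀ hβ.ne_zero]; simp
    rw [h2, norm_mul, norm_zpow]
    calc _ ≤ ‖β‖ * ‖β‖ ^ (-(r + 1)) := by
          gcongr
          exact hβ.norm_le_norm hs1
      _ = ‖β‖ ^ (-r) := by rw [← zpow_one_add₀ hp.ne']; congr 1; ring
  choose! d hdS hd using hdig
  rw [mul_comm]
  refine (Finset.card_le_mul_card_image_of_maps_to (f := d) (t := S) hdS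
    (ballGrid S β n r).card fun s hs => ?_)
  have hsn : ‖s * β ^ (-(r + 1))‖ ≤ ‖β‖ ^ (-(n : ℤ)) := by
    rw [norm_mul, norm_zpow]
    exact (mul_le_of_le_one_left (zpow_pos hp _).le (hS.norm_le_one s hs)).trans
      (hβ.zpow_le_zpow_iff.2 hrn)
  have hb : ∀ ξ ∈ grid S β n, ‖ξ - s * β ^ (-(r + 1))‖ ≤ ‖β‖ ^ (-(n : ℤ)) := fun ξ hξ =>
    norm_sub_le_of_le (hβ.norm_le_of_mem_grid hS hξ) hsn
  refine Finset.card_le_card_of_injOn (fun ξ => gridRep S β n (ξ - s * β ^ (-(r + 1)))) ?_ ?_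
  · intro ξ hξ
    obtain ⟨hξ', rfl⟩ := Finset.mem_filter.1 hξ
    obtain ⟨h1, h2⟩ := hβ.gridRep_spec hS (hb ξ (mem_ballGrid.1 hξ').1)
    refine mem_ballGrid.2 ⟨h1, ?_⟩
    have := norm_sub_le_of_le (hd ξ hξ')
      (h2.trans (by simpa using hβ.zpow_le_zpow_iff.2 hr : ‖β‖ ^ (n : ℤ) ≤ ‖β‖ ^ (-r)))
    simpa using this
  · intro ξ hξ η hη heq
    have hξ' := (mem_ballGrid.1 (Finset.mem_filter.1 hξ).1).1
    have hη' := (mem_ballGrid.1 (Finset.mem_filter.1 hη).1).1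
    have h1 := (hβ.gridRep_spec hS (hb ξ hξ')).2
    have h2 := (hβ.gridRep_spec hS (hb η hη')).2
    dsimp only at heq
    rw [heq] at h1
    refine hβ.eq_of_mem_grid hS hξ' hη' ?_
    simpa using norm_sub_le_of_le h1 h2

lemma IsRankZeroCharacter.card_ballGrid_le (hβ : IsUniformizer β) (hS : IsDigitSet S)
    (hχ : IsRankZeroCharacter β χ) {n : ℕ} (j : ℕ) (hj : j ≤ n) :
    (ballGrid S β n j).card ≤ S.card ^ (n + j) := by
  induction j with
  | zero =>
    -- The unit ball is its own dual, so the square of its cardinality is `q ^ (2n)`.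
    have := hχ.card_ballGrid_mul hβ hS (n := n) (r := 0) (by omega) (by omega)
    rw [neg_zero, ← sq, mul_comm, pow_mul] at this
    simpa using (Nat.pow_left_injective (two_ne_zero) this).le
  | succ j ih =>
    have := hβ.card_ballGrid_succ_le hS (n := n) (r := j) (by omega) (by omega)
    push_cast
    refine this.trans ?_
    rw [← add_assoc, pow_succ']
    exact Nat.mul_le_mul_left _ (ih (by omega))

open scoped ComplexOrder in
/-- The Fourier transform of a radially decreasing nonnegative function is nonnegative. -/
lemma IsRankZeroCharacter.sum_antitone_nonneg (hβ : IsUniformizer β) (hS : IsDigitSet S)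
    (hχ : IsRankZeroCharacter β χ) {n : ℕ} {g : ℝ → ℝ} (hg : AntitoneOn g (Ici 0))
    (hg0 : 0 ≤ g (‖β‖ ^ (-(n : ℤ)))) {z : K} (hz : ‖z‖ ≤ ‖β‖ ^ (-(n : ℤ))) :
    0 ≤ ∑ ξ ∈ grid S β n, (g ‖ξ‖ : ℂ) * (χ (z * ξ) : ℂ) := by
  have hp := hβ.norm_pos
  have hσ : ∀ r : ℤ, -(n : ℤ) ≤ r → r ≤ n → 0 ≤ ∑ ξ ∈ ballGrid S β n r, (χ (z * ξ) : ℂ) := by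
    intro r hr hrn
    rw [hχ.sum_ballGrid hβ hS hr hrn hz]
    split_ifs
    · exact Nat.cast_nonneg _
    · exact le_rfl
  -- A layer-cake induction on the radius. The summand vanishes on the outermost sphere, so
  -- enlarging the radius only adds a nonnegative multiple of the indicator of the smaller ball,
  -- whose transform is nonnegative by `hσ`. The constant `g (‖β‖ ^ (-n))` is restored at the end.
  have key : ∀ j : ℕ, j ≤ 2 * n → 0 ≤ ∑ ξ ∈ ballGrid S β n (j - n),
      ((g ‖ξ‖ - g (‖β‖ ^ (-((j : ℤ) - n))) : ℝ) : ℂ) * (χ (z * ξ) : ℂ) := by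
    intro j
    induction j with
    | zero =>
      intro _
      rw [Nat.cast_zero, zero_sub, hβ.ballGrid_neg hS, Finset.sum_singleton]
      simp only [norm_zero, mul_zero, AddChar.map_zero_eq_one, Circle.coe_one, mul_one]
      rw [Complex.zero_le_real, sub_nonneg]
      exact hg (by simp) (zpow_pos hp _).le (zpow_pos hp _).le
    | succ j ih =>
      intro hj
      have hsub : ballGrid S β n (j - n) ⊆ ballGrid S β n ((j + 1 : ℕ) - n) := by
        intro ξ hξ
        obtain ⟨h1, h2⟩ := mem_ballGrid.1 hξ
        exact mem_ballGrid.2 ⟨h1, h2.trans (hβ.zpow_le_zpow_iff.2 (by push_cast; omega))⟩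
      rw [← Finset.sum_subset hsub]
      · have h1 : ∑ ξ ∈ ballGrid S β n (j - n),
            ((g ‖ξ‖ - g (‖β‖ ^ (-(((j + 1 : ℕ) : ℤ) - n))) : ℝ) : ℂ) * (χ (z * ξ) : ℂ) =
            ∑ ξ ∈ ballGrid S β n (j - n),
              ((g ‖ξ‖ - g (‖β‖ ^ (-((j : ℤ) - n))) : ℝ) : ℂ) * (χ (z * ξ) : ℂ) +
            ((g (‖β‖ ^ (-((j : ℤ) - n))) - g (‖β‖ ^ (-(((j + 1 : ℕ) : ℤ) - n))) : ℝ) : ℂ) *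
              ∑ ξ ∈ ballGrid S β n (j - n), (χ (z * ξ) : ℂ) := by
          rw [Finset.mul_sum, ← Finset.sum_add_distrib]
          refine Finset.sum_congr rfl fun ξ _ => ?_
          push_cast
          ring
        rw [h1]
        refine add_nonneg (ih (by omega)) (mul_nonneg ?_ (hσ _ (by omega) (by omega)))
        rw [Complex.zero_le_real, sub_nonneg]
        exact hg (zpow_pos hp _).le (zpow_pos hp _).le
          (hβ.zpow_le_zpow_iff.2 (by push_cast; omega))
      · intro ξ hξ hξ'
        obtain ⟨h1, h2⟩ := mem_ballGrid.1 hξ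
        have h3 : ¬ ‖ξ‖ ≤ ‖β‖ ^ (-((j : ℤ) - n)) := fun h => hξ' (mem_ballGrid.2 ⟨h1, h⟩)
        have hξ0 : ξ ≠ 0 := by
          rintro rfl
          exact h3 (by simpa only [norm_zero] using (zpow_pos hp _).le)
        obtain ⟨m, hm⟩ := hβ.exists_norm_eq hξ0
        rw [hm, hβ.zpow_le_zpow_iff] at h2 h3
        have : m = ((j + 1 : ℕ) : ℤ) - n := by push_cast at h2 ⊢; omega
        rw [hm, this]
        simp
  have h := key (2 * n) le_rfl
  have e : ((2 * n : ℕ) : ℤ) - n = n := by push_cast; ring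
  rw [e, hβ.ballGrid_self hS] at h
  have hn := hσ n (by omega) le_rfl
  rw [hβ.ballGrid_self hS] at hn
  have := add_nonneg h (mul_nonneg (Complex.zero_le_real.2 hg0) hn)
  rw [Finset.mul_sum, ← Finset.sum_add_distrib] at this
  convert this using 2 with ξ
  push_cast
  ring

end Characters

/-! ### The densities `p_{s,n}`: positivity, mass, tails and a bound uniform in `n`. -/

section Density

variable {K : Type*} [NontriviallyNormedField K] {β : K} {S : Finset K} {χ : AddChar K Circle}
  {α : ℝ} {n : ℕ} {s : ℝ}

lemma density_neg (x : K) : density S β χ α n s (-x) = density S β χ α n s x := by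
  unfold density finiteFourierInv
  rw [← Complex.conj_re]
  simp only [map_mul, map_inv₀, map_pow, Complex.conj_natCast, map_sum, Complex.conj_ofReal,
    neg_mul, AddChar.map_neg_eq_inv, Circle.coe_inv_eq_conj, Complex.conj_conj]

lemma density_eq_sum (x : K) : density S β χ α n s x =
    ((S.card : ℝ) ^ n)⁻¹ * ∑ ξ ∈ grid S β n, Real.exp (-s * ‖ξ‖ ^ α) * (χ (x * ξ) : ℂ).re := by
  unfold density finiteFourierInv
  have : ((S.card : ℂ) ^ n)⁻¹ = (((S.card : ℝ) ^ n)⁻¹ : ℝ) := by push_cast; rfl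
  rw [this, Complex.re_ofReal_mul, Complex.re_sum]
  simp only [Complex.re_ofReal_mul]

lemma density_zero_eq : density S β χ α n s 0 =
    ((S.card : ℝ) ^ n)⁻¹ * ∑ ξ ∈ grid S β n, Real.exp (-s * ‖ξ‖ ^ α) := by
  simp [density_eq_sum]

lemma density_le_density_zero (x : K) : density S β χ α n s x ≤ density S β χ α n s 0 := by
  rw [density_zero_eq, density_eq_sum]
  gcongr with ξ
  refine mul_le_of_le_one_right (Real.exp_pos _).le ?_
  exact (Complex.re_le_norm _).trans (Circle.norm_coe _).le

lemma density_zero_anti {s' : ℝ} (h : s ≤ s') :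
    density S β χ α n s' 0 ≤ density S β χ α n s 0 := by
  rw [density_zero_eq, density_zero_eq]
  gcongr

lemma density_zero_pos (hS : IsDigitSet S) : 0 < density S β χ α n s 0 := by
  rw [density_zero_eq]
  have := hS.card_pos
  refine mul_pos (by positivity) (Finset.sum_pos (fun ξ _ => Real.exp_pos _)
    ⟨0, hS.zero_mem_grid n⟩)

lemma antitoneOn_exp_neg_mul_rpow (hα : 0 < α) (hs : 0 ≤ s) :
    AntitoneOn (fun y : ℝ => Real.exp (-s * y ^ α)) (Ici 0) := by
  intro x hx y _ hxy
  have : x ^ α ≤ y ^ α := Real.rpow_le_rpow hx hxy hα.le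
  simp only [Real.exp_le_exp]
  nlinarith

/-- The ratio of consecutive terms, `q exp (-s (b-1) b^j)`, tends to zero. The series dominates
`p_{s,n}(0)` for all `n` at once. -/
lemma summable_pow_mul_exp_neg (q : ℝ) (hq : 0 < q) (hs : 0 < s) {b : ℝ} (hb : 1 < b) :
    Summable fun j : ℕ => q ^ j * Real.exp (-s * b ^ j) := by
  refine summable_of_ratio_test_tendsto_lt_one zero_lt_one (Eventually.of_forall fun j =>
    (by positivity)) ?_
  have h1 : ∀ j : ℕ, ‖q ^ (j + 1) * Real.exp (-s * b ^ (j + 1))‖ / ‖q ^ j * Real.exp (-s * b ^ j)‖ =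
      q * Real.exp (-(b ^ j * (s * (b - 1)))) := by
    intro j
    rw [Real.norm_of_nonneg (by positivity), Real.norm_of_nonneg (by positivity),
      div_eq_iff (by positivity)]
    have : Real.exp (-s * b ^ (j + 1)) =
        Real.exp (-(b ^ j * (s * (b - 1)))) * Real.exp (-s * b ^ j) := by
      rw [← Real.exp_add]; congr 1; ring
    rw [this]; ring
  simp_rw [h1]
  have h2 : Tendsto (fun j : ℕ => b ^ j * (s * (b - 1))) atTop atTop :=
    (tendsto_pow_atTop_atTop_of_one_lt hb).atTop_mul_const (mul_pos hs (by linarith))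
  simpa using (Real.tendsto_exp_neg_atTop_nhds_zero.comp h2).const_mul q

variable [IsUltrametricDist K]

open scoped ComplexOrder in
lemma IsRankZeroCharacter.finiteFourierInv_nonneg (hβ : IsUniformizer β) (hS : IsDigitSet S)
    (hχ : IsRankZeroCharacter β χ) (hα : 0 < α) (hs : 0 ≤ s) {x : K}
    (hx : ‖x‖ ≤ ‖β‖ ^ (-(n : ℤ))) :
    0 ≤ finiteFourierInv S β χ n (fun ξ => (Real.exp (-s * ‖ξ‖ ^ α) : ℂ)) x := by
  have h := hχ.sum_antitone_nonneg hβ hS (antitoneOn_exp_neg_mul_rpow hα hs)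
    (Real.exp_pos _).le hx
  have hq : (0 : ℂ) ≤ ((S.card : ℂ) ^ n)⁻¹ := by
    have : ((S.card : ℂ) ^ n)⁻¹ = (((S.card : ℝ) ^ n)⁻¹ : ℝ) := by push_cast; rfl
    rw [this, Complex.zero_le_real]
    positivity
  exact mul_nonneg hq h

lemma IsRankZeroCharacter.density_nonneg (hβ : IsUniformizer β) (hS : IsDigitSet S)
    (hχ : IsRankZeroCharacter β χ) (hα : 0 < α) (hs : 0 ≤ s) {x : K}
    (hx : ‖x‖ ≤ ‖β‖ ^ (-(n : ℤ))) : 0 ≤ density S β χ α n s x :=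
  (Complex.le_def.1 (hχ.finiteFourierInv_nonneg hβ hS hα hs hx)).1

/-- Nonnegativity in the order of `ℂ` includes vanishing of the imaginary part, so taking `re` in
`density` loses nothing. -/
lemma IsRankZeroCharacter.ofReal_density (hβ : IsUniformizer β) (hS : IsDigitSet S)
    (hχ : IsRankZeroCharacter β χ) (hα : 0 < α) (hs : 0 ≤ s) {x : K}
    (hx : ‖x‖ ≤ ‖β‖ ^ (-(n : ℤ))) :
    (density S β χ α n s x : ℂ) =
      finiteFourierInv S β χ n (fun ξ => (Real.exp (-s * ‖ξ‖ ^ α) : ℂ)) x :=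
  Complex.ext rfl (Complex.le_def.1 (hχ.finiteFourierInv_nonneg hβ hS hα hs hx)).2

/-- The mass which the density `p_{s,n}` gives to a ball. -/
lemma IsRankZeroCharacter.sum_density_ball (hβ : IsUniformizer β) (hS : IsDigitSet S)
    (hχ : IsRankZeroCharacter β χ) {r : ℤ} (hr : -(n : ℤ) ≤ r) (hrn : r ≤ n) {x : K}
    (hx : ‖x‖ ≤ ‖β‖ ^ (-(n : ℤ))) :
    ∑ y ∈ grid S β n with ‖y - x‖ ≤ ‖β‖ ^ (-r), density S β χ α n s (y - x) =
      ((S.card : ℝ) ^ n)⁻¹ * (ballGrid S β n r).card *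
        ∑ ξ ∈ ballGrid S β n (-r), Real.exp (-s * ‖ξ‖ ^ α) := by
  -- Summing a character over a ball gives a multiple of the indicator of the dual ball; recentring
  -- the ball from `x` to `0` is translation invariance.
  have h1 : ∀ ξ ∈ grid S β n, ∑ y ∈ grid S β n with ‖y - x‖ ≤ ‖β‖ ^ (-r),
      (χ ((y - x) * ξ) : ℂ) = if ‖ξ‖ ≤ ‖β‖ ^ r then ((ballGrid S β n r).card : ℂ) else 0 := by
    intro ξ hξ
    have hξ' := hβ.norm_le_of_mem_grid hS hξ
    rw [← hχ.sum_ballGrid hβ hS hr hrn hξ', ballGrid, Finset.sum_filter, Finset.sum_filter]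
    have h2 := hβ.sum_grid_add hS (n := n)
      (fun z => if ‖z‖ ≤ ‖β‖ ^ (-r) then (χ (ξ * z) : ℂ) else 0) (h := -x) ?_ (by rwa [norm_neg])
    · rw [← h2]
      refine Finset.sum_congr rfl fun y _ => ?_
      rw [← sub_eq_add_neg, mul_comm ξ]
    · intro z w hz hw
      have hw' : ‖w‖ ≤ ‖β‖ ^ (-r) := hw.trans (by simpa using hβ.zpow_le_zpow_iff.2 hr)
      simp only [norm_add_le_iff hw', hχ.map_mul_add hβ hξ' hw]
  simp_rw [density_eq_sum]
  rw [← Finset.mul_sum, Finset.sum_comm, mul_assoc]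
  congr 1
  rw [Finset.mul_sum, ballGrid, Finset.sum_filter, neg_neg]
  refine Finset.sum_congr rfl fun ξ hξ => ?_
  rw [← Finset.mul_sum, ← Complex.re_sum, h1 ξ hξ]
  split_ifs
  · rw [Complex.natCast_re, mul_comm]
  · simp

lemma IsRankZeroCharacter.sum_density (hβ : IsUniformizer β) (hS : IsDigitSet S)
    (hχ : IsRankZeroCharacter β χ) (hα : 0 < α) {x : K} (hx : ‖x‖ ≤ ‖β‖ ^ (-(n : ℤ))) :
    ∑ y ∈ grid S β n, density S β χ α n s (y - x) = (S.card : ℝ) ^ n := by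
  -- For `r = n` the ball is the whole grid and its dual is `{0}`, where the exponential equals 1.
  have h := hχ.sum_density_ball (s := s) (α := α) hβ hS (r := n) (by omega) le_rfl hx
  rw [Finset.filter_true_of_mem fun y hy => norm_sub_le_of_le (hβ.norm_le_of_mem_grid hS hy) hx,
    hβ.ballGrid_self hS, hβ.card_grid hS, hβ.ballGrid_neg hS] at h
  rw [h]
  have : (S.card : ℝ) ≠ 0 := by exact_mod_cast hS.card_pos.ne'
  simp [Real.zero_rpow hα.ne', two_mul, pow_add]
  field_simp

/-- The mass of the ball is `qⁿ` times the average of `exp (-s ‖ξ‖^α)` over the dual ball `‖ξ‖ ≤ ‖β‖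
^ r`, and there `exp (-u) ≥ 1 - u` gives at least `1 - s (‖β‖ ^ r)^α`. The total mass is `qⁿ`. -/
lemma IsRankZeroCharacter.sum_density_tail_le (hβ : IsUniformizer β) (hS : IsDigitSet S)
    (hχ : IsRankZeroCharacter β χ) (hα : 0 < α) (hs : 0 ≤ s) {r : ℤ} (hr : -(n : ℤ) ≤ r)
    (hrn : r ≤ n) {x : K} (hx : ‖x‖ ≤ ‖β‖ ^ (-(n : ℤ))) :
    ∑ y ∈ grid S β n with ¬ ‖y - x‖ ≤ ‖β‖ ^ (-r), density S β χ α n s (y - x) ≤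
      (S.card : ℝ) ^ n * (s * (‖β‖ ^ r) ^ α) := by
  have h1 := Finset.sum_filter_add_sum_filter_not (grid S β n) (fun y => ‖y - x‖ ≤ ‖β‖ ^ (-r))
    (fun y => density S β χ α n s (y - x))
  rw [hχ.sum_density hβ hS hα hx, hχ.sum_density_ball hβ hS hr hrn hx] at h1
  have hq : (0 : ℝ) < (S.card : ℝ) ^ n := pow_pos (by exact_mod_cast hS.card_pos) n
  have h2 : (ballGrid S β n (-r)).card * (1 - s * (‖β‖ ^ r) ^ α) ≤
      ∑ ξ ∈ ballGrid S β n (-r), Real.exp (-s * ‖ξ‖ ^ α) := by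
    rw [← nsmul_eq_mul]
    refine Finset.card_nsmul_le_sum _ _ _ fun ξ hξ => ?_
    have h3 : ‖ξ‖ ^ α ≤ (‖β‖ ^ r) ^ α :=
      Real.rpow_le_rpow (norm_nonneg _) (by simpa using (mem_ballGrid.1 hξ).2) hα.le
    have h4 := Real.add_one_le_exp (-s * ‖ξ‖ ^ α)
    nlinarith
  have h5 : ((ballGrid S β n r).card : ℝ) * (ballGrid S β n (-r)).card =
      (S.card : ℝ) ^ n * (S.card : ℝ) ^ n := by
    rw [← pow_add, ← two_mul]
    exact_mod_cast hχ.card_ballGrid_mul hβ hS hr hrn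
  have h6 : (S.card : ℝ) ^ n * (1 - s * (‖β‖ ^ r) ^ α) ≤
      ((S.card : ℝ) ^ n)⁻¹ * (ballGrid S β n r).card *
        ∑ ξ ∈ ballGrid S β n (-r), Real.exp (-s * ‖ξ‖ ^ α) := by
    calc _ = ((S.card : ℝ) ^ n)⁻¹ * (ballGrid S β n r).card *
          ((ballGrid S β n (-r)).card * (1 - s * (‖β‖ ^ r) ^ α)) := by
          rw [mul_assoc, ← mul_assoc (_ : ℝ) ((ballGrid S β n (-r)).card : ℝ), h5]
          field_simp
      _ ≤ _ := by gcongr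
  linarith

/-- The exponential is dominated by a sum over `j ≥ 0` of multiples of indicators of the balls
`B_j`. Each has at most `q ^ (n+j)` grid points, so the prefactor `q⁻ⁿ` cancels and a convergent
series independent of `n` remains. -/
lemma IsRankZeroCharacter.exists_density_zero_le (hβ : IsUniformizer β) (hS : IsDigitSet S)
    (hχ : IsRankZeroCharacter β χ) (hα : 0 < α) (hs : 0 < s) :
    ∃ C : ℝ, ∀ n : ℕ, density S β χ α n s 0 ≤ C := by
  have hp := hβ.norm_pos
  have hq : (0 : ℝ) < S.card := by exact_mod_cast hS.card_pos
  have hb : 1 < ‖β‖ ^ (-α) := Real.one_lt_rpow_of_pos_of_lt_one_of_neg hp hβ.norm_lt_one (by linarith)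
  have hsum := summable_pow_mul_exp_neg (S.card : ℝ) hq hs hb
  refine ⟨Real.exp s * ∑' j : ℕ, (S.card : ℝ) ^ j * Real.exp (-s * (‖β‖ ^ (-α)) ^ j), fun n => ?_⟩
  have hpow : ∀ j : ℕ, (‖β‖ ^ (-(j : ℤ))) ^ α = (‖β‖ ^ (-α)) ^ j := by
    intro j
    rw [← Real.rpow_natCast, ← Real.rpow_intCast, ← Real.rpow_mul hp.le, ← Real.rpow_mul hp.le]
    push_cast
    ring_nf
  have h1 : ∀ ξ ∈ grid S β n, Real.exp (-s * ‖ξ‖ ^ α) ≤ ∑ j ∈ Finset.range (n + 1),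
      if ‖ξ‖ ≤ ‖β‖ ^ (-(j : ℤ)) then Real.exp s * Real.exp (-s * (‖β‖ ^ (-α)) ^ j) else 0 := by
    intro ξ hξ
    have hnn : ∀ j ∈ Finset.range (n + 1), (0 : ℝ) ≤
        if ‖ξ‖ ≤ ‖β‖ ^ (-(j : ℤ)) then Real.exp s * Real.exp (-s * (‖β‖ ^ (-α)) ^ j) else 0 := by
      intro j _
      split_ifs <;> positivity
    by_cases h : ‖ξ‖ ≤ 1
    -- The factor `exp s` makes the term `j = 0` equal to 1, which covers the whole unit ball.
    · refine le_trans ?_ (Finset.single_le_sum hnn (Finset.mem_range.2 (Nat.succ_pos n)))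
      rw [if_pos (by simpa using h), ← Real.exp_add, Real.exp_le_exp]
      have : 0 ≤ ‖ξ‖ ^ α := by positivity
      simp
      positivity
    · have hξ0 : ξ ≠ 0 := by rintro rfl; simp at h
      obtain ⟨m, hm⟩ := hβ.exists_norm_eq hξ0
      have hm0 : 0 ≤ m := by
        by_contra! hlt
        refine h ?_
        rw [hm]
        exact (zpow_le_zpow_right_of_le_one₀ hp hβ.norm_lt_one.le
          (by omega : 0 ≤ -m)).trans_eq (zpow_zero _)
      lift m to ℕ using hm0
      have hmn : m ≤ n := by
        have := hβ.norm_le_of_mem_grid hS hξ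
        rw [hm, hβ.zpow_le_zpow_iff] at this
        omega
      refine le_trans ?_ (Finset.single_le_sum hnn (Finset.mem_range.2 (Nat.lt_succ_of_le hmn)))
      rw [if_pos hm.le, hm, hpow]
      exact le_mul_of_one_le_left (Real.exp_pos _).le (Real.one_le_exp hs.le)
  rw [density_zero_eq, inv_mul_le_iff₀ (pow_pos hq n)]
  calc ∑ ξ ∈ grid S β n, Real.exp (-s * ‖ξ‖ ^ α)
      ≤ ∑ ξ ∈ grid S β n, ∑ j ∈ Finset.range (n + 1),
        if ‖ξ‖ ≤ ‖β‖ ^ (-(j : ℤ)) then Real.exp s * Real.exp (-s * (‖β‖ ^ (-α)) ^ j) else 0 :=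
        Finset.sum_le_sum h1
    _ = ∑ j ∈ Finset.range (n + 1), ((ballGrid S β n j).card : ℝ) *
        (Real.exp s * Real.exp (-s * (‖β‖ ^ (-α)) ^ j)) := by
        rw [Finset.sum_comm]
        refine Finset.sum_congr rfl fun j _ => ?_
        rw [← Finset.sum_filter, Finset.sum_const, nsmul_eq_mul, ballGrid]
    _ ≤ ∑ j ∈ Finset.range (n + 1), (S.card : ℝ) ^ (n + j) *
        (Real.exp s * Real.exp (-s * (‖β‖ ^ (-α)) ^ j)) := by
        gcongr with j hj
        exact_mod_cast hχ.card_ballGrid_le hβ hS j (Nat.lt_succ_iff.1 (Finset.mem_range.1 hj))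
    _ = (S.card : ℝ) ^ n * (Real.exp s * ∑ j ∈ Finset.range (n + 1),
        (S.card : ℝ) ^ j * Real.exp (-s * (‖β‖ ^ (-α)) ^ j)) := by
        simp only [Finset.mul_sum]
        exact Finset.sum_congr rfl fun j _ => by rw [pow_add]; ring
    _ ≤ _ := by
        gcongr
        exact hsum.sum_le_tsum _ fun j _ => by positivity

end Density

/-! ### Uniqueness of the path measure by a π-system argument. -/

section Uniqueness

variable {K : Type*} [NontriviallyNormedField K] [MeasurableSpace K] {β : K} {S : Finset K}
  {χ : AddChar K Circle} {α : ℝ} {n : ℕ} {t : ℝ} {a : K}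

lemma measurable_eval_skorokhod (s : Icc (0 : ℝ) t) :
    Measurable fun ω : SkorokhodSpace K t => ω.1 s :=
  (measurable_pi_apply s).comp measurable_subtype_coe

lemma measurableSet_forall_eval_mem {N : ℕ} (τ : Fin N → Icc (0 : ℝ) t) {J : Fin N → Set K}
    (hJ : ∀ i, MeasurableSet (J i)) :
    MeasurableSet {ω : SkorokhodSpace K t | ∀ i, ω.1 (τ i) ∈ J i} := by
  rw [ofPred_forall]
  exact MeasurableSet.iInter fun i => measurable_eval_skorokhod (τ i) (hJ i)

/-- A path measure is determined by its finite-dimensional distributions. -/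
lemma IsPathMeasure.unique {P Q : Measure (SkorokhodSpace K t)}
    (hP : IsPathMeasure S β χ α n t a P) (hQ : IsPathMeasure S β χ α n t a Q) : P = Q := by
  have := hP.1
  have := hQ.1
  have hval : Measurable (Subtype.val : SkorokhodSpace K t → Icc (0 : ℝ) t → K) :=
    measurable_subtype_coe
  have hmap : P.map Subtype.val = Q.map Subtype.val := by
    have := Measure.isProbabilityMeasure_map (μ := P) hval.aemeasurable
    refine ext_of_generate_finite _ generateFrom_squareCylinders.symm
      (isPiSystem_squareCylinders (fun _ => MeasurableSpace.isPiSystem_measurableSet) (by simp)) ?_ ?_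
    · rintro - ⟨I, J, hJ, rfl⟩
      simp only [mem_univ_pi, mem_ofPred_eq] at hJ
      have hm : MeasurableSet ((I : Set (Icc (0 : ℝ) t)).pi J) :=
        MeasurableSet.pi I.countable_toSet fun i _ => hJ i
      rw [Measure.map_apply hval hm, Measure.map_apply hval hm]
      -- Listing the finite index set in increasing order turns a cylinder into an event covered by
      -- the finite-dimensional distributions.
      have hset : (Subtype.val : SkorokhodSpace K t → Icc (0 : ℝ) t → K) ⁻¹'
          ((I : Set (Icc (0 : ℝ) t)).pi J) =
          {ω | ∀ i, ω.1 (I.orderEmbOfFin rfl i) ∈ J (I.orderEmbOfFin rfl i)} := by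
        ext ω
        have hr := I.range_orderEmbOfFin rfl
        simp only [mem_preimage, Set.mem_pi, mem_ofPred_eq, ← hr, forall_mem_range]
      rw [hset, ← measureReal_eq_measureReal_iff,
        hP.2 _ _ _ (I.orderEmbOfFin rfl).strictMono fun i => hJ _,
        hQ.2 _ _ _ (I.orderEmbOfFin rfl).strictMono fun i => hJ _]
    · rw [Measure.map_apply hval MeasurableSet.univ, Measure.map_apply hval MeasurableSet.univ]
      simp
  ext A hA
  obtain ⟨B, hB, rfl⟩ := hA
  rw [← Measure.map_apply hval hB, ← Measure.map_apply hval hB, hmap]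

end Uniqueness

/-! ### Skorokhod paths built from finitely many jumps. -/

section JumpPaths

variable {K : Type*} [NontriviallyNormedField K] {β : K} {S : Finset K} {n : ℕ}

/-- The position at time `s` of the walk which starts at `a` and makes the jump `(w i).2` at the
time `(w i).1`, if this time lies in `(0, t)`. -/
def jumpSum (t : ℝ) (a : K) {m : ℕ} (w : Fin m → ℝ × grid S β n) (s : ℝ) : K :=
  a + ∑ i, if (w i).1 ∈ Ioc 0 s ∩ Iio t then ((w i).2 : K) else 0

/-- The set of jumps made so far is eventually constant on each side of `s`; from the left its limit
contains the jumps strictly before `s`. Excluding jumps at time `t` itself gives left continuity at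
the end point. -/
lemma isSkorokhod_of_jumps {t : ℝ} {m : ℕ} (u : Fin m → ℝ) (F : Set (Fin m) → K) :
    IsSkorokhod fun s : Icc (0 : ℝ) t => F {i | u i ∈ Ioc 0 (s : ℝ) ∩ Iio t} := by
  have hcoe : ∀ s : Icc (0 : ℝ) t, Tendsto (fun r : Icc (0 : ℝ) t => (r : ℝ)) (𝓝[<] s) (𝓝 (s : ℝ)) :=
    fun s => (continuous_subtype_val.tendsto s).mono_left nhdsWithin_le_nhds
  have hleft : ∀ s : Icc (0 : ℝ) t, ∀ᶠ r : Icc (0 : ℝ) t in 𝓝[<] s,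
      {i | u i ∈ Ioc 0 (r : ℝ) ∩ Iio t} = {i | u i ∈ Ioo 0 (s : ℝ) ∩ Iio t} := by
    intro s
    have : ∀ i, ∀ᶠ r : Icc (0 : ℝ) t in 𝓝[<] s, (u i ≤ r ↔ u i < s) := by
      intro i
      have hlt : ∀ᶠ r : Icc (0 : ℝ) t in 𝓝[<] s, (r : ℝ) < s :=
        eventually_nhdsWithin_of_forall fun r hr => hr
      by_cases h : u i < s
      · filter_upwards [(hcoe s).eventually (lt_mem_nhds h)] with r hr
        exact iff_of_true hr.le h
      · filter_upwards [hlt] with r hr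
        exact iff_of_false (by linarith [not_lt.1 h]) h
    filter_upwards [eventually_all.2 this] with r hr
    ext i
    simp [hr i]
  refine ⟨fun s => ?_, fun s => ⟨F {i | u i ∈ Ioo 0 (s : ℝ) ∩ Iio t}, ?_⟩, fun s hs => ?_⟩
  · have : ∀ i, ∀ᶠ r : Icc (0 : ℝ) t in 𝓝[>] s, (u i ≤ r ↔ u i ≤ s) := by
      intro i
      have hlt : ∀ᶠ r : Icc (0 : ℝ) t in 𝓝[>] s, (s : ℝ) < r :=
        eventually_nhdsWithin_of_forall fun r hr => hr
      by_cases h : u i ≤ s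
      · filter_upwards [hlt] with r hr
        exact iff_of_true (by linarith) h
      · have hc : Tendsto (fun r : Icc (0 : ℝ) t => (r : ℝ)) (𝓝[>] s) (𝓝 (s : ℝ)) :=
          (continuous_subtype_val.tendsto s).mono_left nhdsWithin_le_nhds
        filter_upwards [hc.eventually_lt_const (not_le.1 h)] with r hr
        exact iff_of_false (by linarith) h
    refine tendsto_const_nhds.congr' ?_
    filter_upwards [eventually_all.2 this] with r hr
    congr 1
    ext i
    simp [hr i]
  · refine tendsto_const_nhds.congr' ?_
    filter_upwards [hleft s] with r hr
    rw [hr]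
  · refine tendsto_const_nhds.congr' ?_
    filter_upwards [hleft s] with r hr
    rw [hr, hs]
    congr 1
    ext i
    simp only [mem_ofPred_eq, mem_inter_iff, mem_Ioo, mem_Ioc, mem_Iio]
    constructor
    · rintro ⟨⟨h1, h2⟩, h3⟩
      exact ⟨⟨h1, h3⟩, h3⟩
    · rintro ⟨⟨h1, h2⟩, h3⟩
      exact ⟨⟨h1, h2.le⟩, h3⟩

lemma isSkorokhod_gridRep_jumpSum (t : ℝ) (a : K) {m : ℕ} (w : Fin m → ℝ × grid S β n) :
    IsSkorokhod fun s : Icc (0 : ℝ) t => gridRep S β n (jumpSum t a w s) := by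
  classical
  convert isSkorokhod_of_jumps (t := t) (fun i => (w i).1)
    (fun A => gridRep S β n (a + ∑ i, if i ∈ A then ((w i).2 : K) else 0)) using 4 with s
  simp only [jumpSum, mem_ofPred_eq]
  congr!

/-- The walk `jumpSum`, reduced modulo `ball β (-n)`, as a Skorokhod path. -/
def jumpPath (t : ℝ) (a : K) {m : ℕ} (w : Fin m → ℝ × grid S β n) : SkorokhodSpace K t :=
  ⟨fun s => gridRep S β n (jumpSum t a w s), isSkorokhod_gridRep_jumpSum t a w⟩

lemma measurable_jumpPath [MeasurableSpace K] [MeasurableSingletonClass K] (hS : IsDigitSet S)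
    (t : ℝ) (a : K) {m : ℕ} :
    Measurable (jumpPath t a : (Fin m → ℝ × grid S β n) → SkorokhodSpace K t) := by
  classical
  refine Measurable.subtype_mk (measurable_pi_lambda _ fun s => ?_)
  have h1 : Measurable fun (w : Fin m → ℝ × grid S β n) (i : Fin m) =>
      if (w i).1 ∈ Ioc 0 (s : ℝ) ∩ Iio t then (w i).2 else ⟨0, hS.zero_mem_grid n⟩ := by
    refine measurable_pi_lambda _ fun i => Measurable.ite ?_ ?_ measurable_const
    · exact (measurable_fst.comp (measurable_pi_apply i)) (measurableSet_Ioc.inter measurableSet_Iio)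
    · exact measurable_snd.comp (measurable_pi_apply i)
  have h2 : Measurable fun y : Fin m → grid S β n => gridRep S β n (a + ∑ i, (y i : K)) :=
    measurable_of_countable _
  convert h2.comp h1 using 1
  ext w
  simp only [jumpSum, Function.comp_apply]
  congr 2
  refine Finset.sum_congr rfl fun i _ => ?_
  split_ifs <;> rfl

lemma jumpSum_zero (t : ℝ) (a : K) {m : ℕ} (w : Fin m → ℝ × grid S β n) : jumpSum t a w 0 = a := by
  simp [jumpSum]

lemma jumpSum_sub (t : ℝ) (a : K) {m : ℕ} (w : Fin m → ℝ × grid S β n) {r s : ℝ} (hr : 0 ≤ r)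
    (hrs : r ≤ s) : jumpSum t a w s - jumpSum t a w r =
      ∑ i, if (w i).1 ∈ Ioc r s ∩ Iio t then ((w i).2 : K) else 0 := by
  rw [jumpSum, jumpSum, add_sub_add_left_eq_sub, ← Finset.sum_sub_distrib]
  refine Finset.sum_congr rfl fun i _ => ?_
  simp only [mem_inter_iff, mem_Ioc, mem_Iio]
  by_cases h1 : (w i).1 ≤ r
  · have h2 : (w i).1 ≤ s := h1.trans hrs
    have h3 : ¬ r < (w i).1 := not_lt.2 h1
    simp [h1, h2, h3]
  · have h3 : r < (w i).1 := not_le.1 h1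
    have h4 : 0 < (w i).1 := hr.trans_lt h3
    simp [h1, h3, h4]

variable [IsUltrametricDist K]

lemma IsUniformizer.norm_jumpSum_le (hβ : IsUniformizer β) (hS : IsDigitSet S) (t : ℝ) {a : K}
    (ha : a ∈ grid S β n) {m : ℕ} (w : Fin m → ℝ × grid S β n) (s : ℝ) :
    ‖jumpSum t a w s‖ ≤ ‖β‖ ^ (-(n : ℤ)) := by
  refine norm_add_le_of_le (hβ.norm_le_of_mem_grid hS ha)
    (IsUltrametricDist.norm_sum_le_of_forall_le_of_nonneg (zpow_pos hβ.norm_pos _).le fun i _ => ?_)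
  split_ifs
  · exact hβ.norm_le_of_mem_grid hS (w i).2.2
  · simpa only [norm_zero] using (zpow_pos hβ.norm_pos _).le

end JumpPaths

/-! ### Jump rates and the Fourier transform of the jump intensity. -/

section JumpLaw

variable {K : Type*} [NontriviallyNormedField K] {β : K} {S : Finset K} {χ : AddChar K Circle}
  {α : ℝ} {n : ℕ} {t : ℝ}

/-- The total jump rate of the walk on the grid. -/
def jumpRate (β : K) (α : ℝ) (n : ℕ) : ℝ := (‖β‖ ^ (-(n : ℤ))) ^ α

/-- The rate of jumps by `y`; its Fourier transform is `jumpRate β α n - ‖·‖ ^ α`. -/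
def jumpWeight (S : Finset K) (β : K) (χ : AddChar K Circle) (α : ℝ) (n : ℕ) (y : K) : ℝ :=
  ((S.card : ℝ) ^ (2 * n))⁻¹ *
    (∑ ξ ∈ grid S β n, ((jumpRate β α n - ‖ξ‖ ^ α : ℝ) : ℂ) * (χ (y * ξ) : ℂ)).re

/-- The jump measure of the walk on the grid. -/
def jumpLaw [MeasurableSpace K] (S : Finset K) (β : K) (χ : AddChar K Circle) (α : ℝ) (n : ℕ) :
    Measure (grid S β n) :=
  ∑ y : grid S β n, ENNReal.ofReal (jumpWeight S β χ α n y) • Measure.dirac y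

instance [MeasurableSpace K] : IsFiniteMeasure (jumpLaw S β χ α n) := by
  refine ⟨?_⟩
  simp only [jumpLaw, Measure.coe_finsetSum, Finset.sum_apply, Measure.smul_apply,
    measure_univ, smul_eq_mul, mul_one]
  exact ENNReal.sum_lt_top.2 fun y _ => ENNReal.ofReal_lt_top

/-- The intensity measure of jump times and jumps. -/
def jumpIntensity [MeasurableSpace K] (S : Finset K) (β : K) (χ : AddChar K Circle) (α : ℝ) (n : ℕ)
    (t : ℝ) : Measure (ℝ × grid S β n) :=
  (volume.restrict (Ioc 0 t)).prod (jumpLaw S β χ α n)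

instance [MeasurableSpace K] : IsFiniteMeasure (jumpIntensity S β χ α n t) := by
  unfold jumpIntensity
  infer_instance

/-- The law of the compound Poisson process with jump measure `jumpLaw S β χ α n`. -/
def compoundPoisson [MeasurableSpace K] (S : Finset K) (β : K) (χ : AddChar K Circle) (α : ℝ)
    (n : ℕ) (t : ℝ) (a : K) : Measure (SkorokhodSpace K t) :=
  Measure.sum fun m : ℕ =>
    ENNReal.ofReal (Real.exp (-(jumpRate β α n * t)) / m.factorial) •
      (Measure.pi fun _ : Fin m => jumpIntensity S β χ α n t).map (jumpPath t a)

/-- At most one factor differs from 1. This turns a product over disjoint time intervals into a sum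
that can be integrated term by term. -/
lemma prod_ite_eq_one_add_sum {ι R X : Type*} [Fintype ι] [CommRing R] {A : ι → Set X}
    (hA : Pairwise (Function.onFun Disjoint A)) (c : ι → R) (u : X)
    [∀ j, Decidable (u ∈ A j)] :
    ∏ j, (if u ∈ A j then c j else 1) = 1 + ∑ j, (A j).indicator 1 u * (c j - 1) := by
  by_cases h : ∃ j, u ∈ A j
  · obtain ⟨j, hj⟩ := h
    have hne : ∀ i, i ≠ j → u ∉ A i := fun i hi hu => Set.disjoint_left.1 (hA hi) hu hj
    rw [Finset.prod_eq_single j (fun i _ hi => if_neg (hne i hi)) (by simp),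
      Finset.sum_eq_single j (fun i _ hi => by simp [hne i hi]) (by simp)]
    simp [hj]
  · push Not at h
    simp [h]

lemma antitoneOn_jumpRate_sub (hα : 0 < α) :
    AntitoneOn (fun y : ℝ => jumpRate β α n - y ^ α) (Ici 0) := fun _ hx _ _ hxy =>
  sub_le_sub_left (Real.rpow_le_rpow hx hxy hα.le) _

variable [IsUltrametricDist K]

/-- `jumpRate β α n` is the value of `‖ξ‖^α` at the radius of `B_n`, so `jumpRate β α n - ‖ξ‖^α` is
radially decreasing and ends at 0; `sum_antitone_nonneg` then makes the weights genuine rates. -/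
lemma IsRankZeroCharacter.ofReal_jumpWeight (hβ : IsUniformizer β) (hS : IsDigitSet S)
    (hχ : IsRankZeroCharacter β χ) (hα : 0 < α) {y : K} (hy : ‖y‖ ≤ ‖β‖ ^ (-(n : ℤ))) :
    0 ≤ jumpWeight S β χ α n y ∧ (jumpWeight S β χ α n y : ℂ) = ((S.card : ℂ) ^ (2 * n))⁻¹ *
      ∑ ξ ∈ grid S β n, ((jumpRate β α n - ‖ξ‖ ^ α : ℝ) : ℂ) * (χ (y * ξ) : ℂ) := by
  have h := hχ.sum_antitone_nonneg hβ hS (antitoneOn_jumpRate_sub (β := β) (n := n) hα)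
    (by simp [jumpRate]) hy
  obtain ⟨h1, h2⟩ := Complex.le_def.1 h
  refine ⟨mul_nonneg (by positivity) h1, ?_⟩
  rw [jumpWeight, Complex.ofReal_mul]
  congr 1
  · push_cast; rfl
  · exact Complex.ext rfl h2

/-- Fourier inversion on the grid, by orthogonality of characters. -/
lemma IsRankZeroCharacter.integral_jumpLaw [MeasurableSpace K] [MeasurableSingletonClass K]
    (hβ : IsUniformizer β) (hS : IsDigitSet S) (hχ : IsRankZeroCharacter β χ) (hα : 0 < α) {ξ : K}
    (hξ : ξ ∈ grid S β n) :
    ∫ y : grid S β n, (χ (-(y * ξ)) : ℂ) ∂(jumpLaw S β χ α n) =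
      ((jumpRate β α n - ‖ξ‖ ^ α : ℝ) : ℂ) := by
  classical
  have hq : (S.card : ℂ) ^ (2 * n) ≠ 0 := pow_ne_zero _ (by exact_mod_cast hS.card_pos.ne')
  rw [jumpLaw, integral_finsetSum_measure fun _ _ => (integrable_dirac (by simp)).smul_measure (by simp)]
  have h1 : ∀ y : grid S β n, ∫ y : grid S β n, (χ (-(y * ξ)) : ℂ)
      ∂(ENNReal.ofReal (jumpWeight S β χ α n y) • Measure.dirac y) =
      ((S.card : ℂ) ^ (2 * n))⁻¹ * ∑ η ∈ grid S β n,
        ((jumpRate β α n - ‖η‖ ^ α : ℝ) : ℂ) * (χ ((η - ξ) * y) : ℂ) := by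
    intro y
    obtain ⟨h2, h3⟩ := hχ.ofReal_jumpWeight hβ hS hα (hβ.norm_le_of_mem_grid hS y.2)
    rw [integral_smul_measure, integral_dirac, ENNReal.toReal_ofReal h2, Complex.real_smul, h3,
      mul_assoc, Finset.sum_mul]
    congr 1
    refine Finset.sum_congr rfl fun η _ => ?_
    rw [mul_assoc, ← Circle.coe_mul, ← AddChar.map_add_eq_mul]
    congr 4
    ring
  rw [Finset.sum_congr rfl fun y _ => h1 y, ← Finset.mul_sum,
    Finset.sum_coe_sort (grid S β n) (fun y => ∑ η ∈ grid S β n,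
        ((jumpRate β α n - ‖η‖ ^ α : ℝ) : ℂ) * (χ ((η - ξ) * y) : ℂ)), Finset.sum_comm]
  have h4 : ∀ η ∈ grid S β n, ∑ y ∈ grid S β n,
      ((jumpRate β α n - ‖η‖ ^ α : ℝ) : ℂ) * (χ ((η - ξ) * y) : ℂ) =
      if η = ξ then ((jumpRate β α n - ‖ξ‖ ^ α : ℝ) : ℂ) * (S.card : ℂ) ^ (2 * n) else 0 := by
    intro η hη
    rw [← Finset.mul_sum, hχ.sum_grid hβ hS (norm_sub_le_of_le (hβ.norm_le_of_mem_grid hS hη)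
      (hβ.norm_le_of_mem_grid hS hξ))]
    by_cases h : η = ξ
    · subst h
      rw [if_pos (by simp), if_pos rfl]
    · rw [if_neg fun h' => h (hβ.eq_of_mem_grid hS hη hξ h'), if_neg h, mul_zero]
  rw [Finset.sum_congr rfl h4, Finset.sum_ite_eq', if_pos hξ]
  field_simp

lemma volume_real_Ioc_inter_Iio {r s : ℝ} (hr : 0 ≤ r) (hrs : r ≤ s) (hs : s ≤ t) :
    (volume.restrict (Ioc 0 t)).real (Ioc r s ∩ Iio t) = s - r := by
  rw [measureReal_def, Measure.restrict_apply (measurableSet_Ioc.inter measurableSet_Iio)]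
  have h : volume (Ioc r s ∩ Iio t ∩ Ioc 0 t) = ENNReal.ofReal (s - r) := by
    refine le_antisymm ?_ ?_
    · rw [← Real.volume_Ioc]
      exact measure_mono fun x hx => hx.1.1
    · rw [← Real.volume_Ioo]
      refine measure_mono fun x hx => ?_
      exact ⟨⟨⟨hx.1, hx.2.le⟩, hx.2.trans_le hs⟩, hr.trans_lt hx.1, hx.2.le.trans hs⟩
  rw [h, ENNReal.toReal_ofReal (by linarith)]

variable [MeasurableSpace K] [MeasurableSingletonClass K]

/-- Joint characteristic function of one jump in disjoint time intervals. -/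
lemma IsRankZeroCharacter.integral_jumpIntensity (hβ : IsUniformizer β) (hS : IsDigitSet S)
    (hχ : IsRankZeroCharacter β χ) (hα : 0 < α) (ht : 0 < t) {N : ℕ} {σ : Fin (N + 1) → ℝ}
    (hσ : Monotone σ) (hσ0 : ∀ i, 0 ≤ σ i) (hσt : ∀ i, σ i ≤ t) {ξ : Fin N → K}
    (hξ : ∀ j, ξ j ∈ grid S β n) :
    Integrable (fun w : ℝ × grid S β n => ∏ j : Fin N,
      (if w.1 ∈ Ioc (σ j.castSucc) (σ j.succ) ∩ Iio t then (χ (-(w.2 * ξ j)) : ℂ) else 1))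
      (jumpIntensity S β χ α n t) ∧
    ∫ w : ℝ × grid S β n, ∏ j : Fin N,
      (if w.1 ∈ Ioc (σ j.castSucc) (σ j.succ) ∩ Iio t then (χ (-(w.2 * ξ j)) : ℂ) else 1)
      ∂(jumpIntensity S β χ α n t) =
    ((jumpRate β α n * t - ∑ j : Fin N, (σ j.succ - σ j.castSucc) * ‖ξ j‖ ^ α : ℝ) : ℂ) := by
  have hA : Pairwise (Function.onFun Disjoint
      fun j : Fin N => Ioc (σ j.castSucc) (σ j.succ) ∩ Iio t) := by
    intro i j hij
    wlog hlt : i < j generalizing i j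
    · exact (this hij.symm (lt_of_le_of_ne (not_lt.1 hlt) hij.symm)).symm
    refine Disjoint.inter_left _ (Disjoint.inter_right _ (Set.disjoint_left.2 fun x hx hx' => ?_))
    exact absurd (hσ (Fin.succ_le_castSucc_iff.2 hlt)) (not_le.2 (hx'.1.trans_le hx.2))
  have hmeas : ∀ j : Fin N, MeasurableSet (Ioc (σ j.castSucc) (σ j.succ) ∩ Iio t) :=
    fun j => measurableSet_Ioc.inter measurableSet_Iio
  have hρ : ∀ f : grid S β n → ℂ, Integrable f (jumpLaw S β χ α n) := fun f => Integrable.of_finite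
  -- The total mass is the transform at `ξ = 0`.
  have hmass : (jumpLaw S β χ α n).real univ = jumpRate β α n := by
    have := hχ.integral_jumpLaw hβ hS hα (hS.zero_mem_grid (β := β) n)
    simp only [mul_zero, neg_zero, AddChar.map_zero_eq_one, Circle.coe_one, integral_const, norm_zero,
      Real.zero_rpow hα.ne', sub_zero, Complex.real_smul, mul_one] at this
    exact_mod_cast this
  have hind : ∀ j : Fin N, Integrable ((Ioc (σ j.castSucc) (σ j.succ) ∩ Iio t).indicator
      (1 : ℝ → ℂ)) (volume.restrict (Ioc 0 t)) := fun j =>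
    (integrable_const (1 : ℂ)).indicator (hmeas j)
  have hterm : ∀ j : Fin N, Integrable (fun w : ℝ × grid S β n =>
      (Ioc (σ j.castSucc) (σ j.succ) ∩ Iio t).indicator (1 : ℝ → ℂ) w.1 *
        ((χ (-(w.2 * ξ j)) : ℂ) - 1)) (jumpIntensity S β χ α n t) := fun j =>
    (hind j).mul_prod (hρ fun y => (χ (-(y * ξ j)) : ℂ) - 1)
  have hexp : (fun w : ℝ × grid S β n => ∏ j : Fin N,
      (if w.1 ∈ Ioc (σ j.castSucc) (σ j.succ) ∩ Iio t then (χ (-(w.2 * ξ j)) : ℂ) else 1)) =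
      fun w => 1 + ∑ j : Fin N, (Ioc (σ j.castSucc) (σ j.succ) ∩ Iio t).indicator (1 : ℝ → ℂ) w.1 *
        ((χ (-(w.2 * ξ j)) : ℂ) - 1) :=
    funext fun w => prod_ite_eq_one_add_sum hA (fun j => (χ (-(w.2 * ξ j)) : ℂ)) w.1
  rw [hexp]
  refine ⟨(integrable_const _).add (integrable_finsetSum _ fun j _ => hterm j), ?_⟩
  rw [integral_add (integrable_const _) (integrable_finsetSum _ fun j _ => hterm j),
    integral_finsetSum _ fun j _ => hterm j]
  have h1 : ∀ j : Fin N, ∫ w : ℝ × grid S β n,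
      (Ioc (σ j.castSucc) (σ j.succ) ∩ Iio t).indicator (1 : ℝ → ℂ) w.1 *
        ((χ (-(w.2 * ξ j)) : ℂ) - 1) ∂(jumpIntensity S β χ α n t) =
      -(((σ j.succ - σ j.castSucc) * ‖ξ j‖ ^ α : ℝ) : ℂ) := by
    intro j
    rw [jumpIntensity, integral_prod_mul (fun u => (Ioc (σ j.castSucc) (σ j.succ) ∩ Iio t).indicator
      (1 : ℝ → ℂ) u) (fun y : grid S β n => (χ (-(y * ξ j)) : ℂ) - 1),
      integral_sub (hρ _) (hρ _), hχ.integral_jumpLaw hβ hS hα (hξ j), integral_indicator (hmeas j)]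
    have h2 := volume_real_Ioc_inter_Iio (hσ0 j.castSucc) (hσ j.castSucc_lt_succ.le) (hσt j.succ)
    simp only [Pi.one_apply, integral_const, measureReal_restrict_apply_univ, h2, hmass,
      Complex.real_smul, mul_one]
    push_cast
    ring
  rw [Finset.sum_congr rfl fun j _ => h1 j, integral_const, jumpIntensity,
    ← univ_prod_univ, measureReal_prod_prod, hmass]
  simp only [measureReal_restrict_apply_univ, Real.volume_real_Ioc_of_le ht.le, Complex.real_smul,
    mul_one, sub_zero, Finset.sum_neg_distrib]
  push_cast
  ring

end JumpLaw

/-! ### The compound Poisson law has the prescribed finite-dimensional distributions. -/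

section Existence

variable {K : Type*} [NontriviallyNormedField K] {β : K} {S : Finset K} {χ : AddChar K Circle}
  {α : ℝ} {n : ℕ} {t : ℝ}

lemma map_addChar_sum {ι : Type*} (s : Finset ι) (f : ι → K) :
    (χ (∑ i ∈ s, f i) : ℂ) = ∏ i ∈ s, (χ (f i) : ℂ) := by
  classical
  induction s using Finset.induction_on with
  | empty => simp
  | insert i s hi ih =>
    rw [Finset.sum_insert hi, Finset.prod_insert hi, AddChar.map_add_eq_mul, Circle.coe_mul, ih]

section Times

variable {N : ℕ} {τ : Fin N → Icc (0 : ℝ) t}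

lemma cons_zero_nonneg (i : Fin (N + 1)) :
    0 ≤ (Fin.cons 0 (fun j => (τ j : ℝ)) : Fin (N + 1) → ℝ) i := by
  refine Fin.cases ?_ (fun j => ?_) i
  · simp
  · simpa using (τ j).2.1

lemma cons_zero_le (ht : 0 < t) (i : Fin (N + 1)) :
    (Fin.cons 0 (fun j => (τ j : ℝ)) : Fin (N + 1) → ℝ) i ≤ t := by
  refine Fin.cases ?_ (fun j => ?_) i
  · simpa using ht.le
  · simpa using (τ j).2.2

lemma monotone_cons_zero (hτ : StrictMono τ) :
    Monotone (Fin.cons 0 (fun j => (τ j : ℝ)) : Fin (N + 1) → ℝ) := by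
  intro i j
  refine Fin.cases (fun _ => ?_) (fun i' => ?_) i
  · simpa using cons_zero_nonneg j
  · refine Fin.cases (fun h => ?_) (fun j' h => ?_) j
    · simp at h
    · simpa using hτ.monotone (Fin.succ_le_succ_iff.1 h)

end Times

variable [IsUltrametricDist K]

/-- The grid points visited at given times are determined by the increments modulo
`ball β (-n)`. -/
lemma IsUniformizer.jumpPath_eq_iff (hβ : IsUniformizer β) (hS : IsDigitSet S) {a : K}
    (ha : a ∈ grid S β n) {m : ℕ} (w : Fin m → ℝ × grid S β n) {N : ℕ} {τ : Fin N → Icc (0 : ℝ) t}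
    {b : Fin N → K} (hb : ∀ j, b j ∈ grid S β n) :
    (∀ j, (jumpPath t a w).1 (τ j) = b j) ↔
      ∀ j : Fin N, ‖((Fin.cons a b : Fin (N + 1) → K) j.succ -
          (Fin.cons a b : Fin (N + 1) → K) j.castSucc) -
        (jumpSum t a w ((Fin.cons 0 (fun j => (τ j : ℝ)) : Fin (N + 1) → ℝ) j.succ) -
          jumpSum t a w ((Fin.cons 0 (fun j => (τ j : ℝ)) : Fin (N + 1) → ℝ) j.castSucc))‖ ≤
        ‖β‖ ^ (n : ℤ) := by
  set σ : Fin (N + 1) → ℝ := Fin.cons 0 (fun j => (τ j : ℝ)) with hσ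
  set B : Fin (N + 1) → K := Fin.cons a b with hB
  have h1 : (∀ j, (jumpPath t a w).1 (τ j) = b j) ↔
      ∀ k : Fin (N + 1), ‖jumpSum t a w (σ k) - B k‖ ≤ ‖β‖ ^ (n : ℤ) := by
    rw [Fin.forall_fin_succ]
    have h0 : ‖jumpSum t a w (σ 0) - B 0‖ ≤ ‖β‖ ^ (n : ℤ) := by
      simp only [hσ, hB, Fin.cons_zero, jumpSum_zero, sub_self, norm_zero]
      exact (zpow_pos hβ.norm_pos _).le
    simp only [h0, true_and]
    refine forall_congr' fun j => ?_
    simp only [hσ, hB, Fin.cons_succ]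
    exact hβ.gridRep_eq_iff hS (hβ.norm_jumpSum_le hS t ha w _) (hb j)
  rw [h1]
  constructor
  · intro h j
    have := norm_sub_le_of_le (h j.castSucc) (h j.succ)
    convert this using 2
    ring
  · intro h k
    induction k using Fin.induction with
    | zero =>
      simp only [hσ, hB, Fin.cons_zero, jumpSum_zero, sub_self, norm_zero]
      exact (zpow_pos hβ.norm_pos _).le
    | succ j ih =>
      have := norm_sub_le_of_le ih (h j)
      convert this using 2
      ring

lemma IsUniformizer.norm_grid_sub_le (hβ : IsUniformizer β) (hS : IsDigitSet S) {a : K}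
    (ha : a ∈ grid S β n) {N : ℕ} {b : Fin N → K} (hb : ∀ j, b j ∈ grid S β n) (j : Fin N) :
    ‖b j - (Fin.cons a b : Fin (N + 1) → K) j.castSucc‖ ≤ ‖β‖ ^ (-(n : ℤ)) := by
  have hB : ∀ k, ‖(Fin.cons a b : Fin (N + 1) → K) k‖ ≤ ‖β‖ ^ (-(n : ℤ)) := by
    refine Fin.cases ?_ fun j => ?_
    · simpa only [Fin.cons_zero] using hβ.norm_le_of_mem_grid hS ha
    · simpa only [Fin.cons_succ] using hβ.norm_le_of_mem_grid hS (hb j)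
  exact norm_sub_le_of_le (hβ.norm_le_of_mem_grid hS (hb j)) (hB _)

variable [MeasurableSpace K] [MeasurableSingletonClass K]

/-- Finite-dimensional distributions of the walk with `m` jumps. -/
lemma IsRankZeroCharacter.pi_jumpIntensity_real (hβ : IsUniformizer β) (hS : IsDigitSet S)
    (hχ : IsRankZeroCharacter β χ) (hα : 0 < α) (ht : 0 < t) {a : K} (ha : a ∈ grid S β n) (m : ℕ)
    {N : ℕ} {τ : Fin N → Icc (0 : ℝ) t} (hτ : StrictMono τ) {b : Fin N → K}
    (hb : ∀ j, b j ∈ grid S β n) :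
    (((Measure.pi fun _ : Fin m => jumpIntensity S β χ α n t).real
      (jumpPath t a ⁻¹' {ω | ∀ j, ω.1 (τ j) = b j}) : ℝ) : ℂ) =
    ∑ ξ ∈ Fintype.piFinset fun _ : Fin N => grid S β n,
      (∏ j : Fin N, ((S.card : ℂ) ^ (2 * n))⁻¹ *
        (χ ((b j - (Fin.cons a b : Fin (N + 1) → K) j.castSucc) * ξ j) : ℂ)) *
      ((jumpRate β α n * t - ∑ j : Fin N, ((τ j : ℝ) -
        (Fin.cons 0 (fun j => (τ j : ℝ)) : Fin (N + 1) → ℝ) j.castSucc) * ‖ξ j‖ ^ α : ℝ) : ℂ) ^ m := by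
  classical
  have hq : (S.card : ℂ) ^ (2 * n) ≠ 0 := pow_ne_zero _ (by exact_mod_cast hS.card_pos.ne')
  set σ : Fin (N + 1) → ℝ := Fin.cons 0 (fun j => (τ j : ℝ)) with hσ
  set B : Fin (N + 1) → K := Fin.cons a b with hB
  have hσ0 : ∀ i, 0 ≤ σ i := cons_zero_nonneg
  have hσm : Monotone σ := monotone_cons_zero hτ
  have hσs : ∀ j : Fin N, (τ j : ℝ) = σ j.succ := fun j => by simp [hσ]
  have hBs : ∀ j : Fin N, b j = B j.succ := fun j => by simp [hB]
  have hmeas : MeasurableSet ((jumpPath t a : (Fin m → ℝ × grid S β n) → SkorokhodSpace K t) ⁻¹'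
      {ω | ∀ j, ω.1 (τ j) = b j}) :=
    measurable_jumpPath hS t a
      (measurableSet_forall_eval_mem τ (J := fun j => {b j}) fun j => measurableSet_singleton _)
  let g : (Fin N → K) → ℝ × grid S β n → ℂ := fun ξ w => ∏ j : Fin N,
    (if w.1 ∈ Ioc (σ j.castSucc) (σ j.succ) ∩ Iio t then (χ (-(w.2 * ξ j)) : ℂ) else 1)
  -- Each increment condition modulo `B_{-n}` is expanded by orthogonality into characters. The
  -- characters of the increments factor over the individual jumps, so integration against the
  -- product measure gives an `m`-th power.
  have hpt : ∀ w : Fin m → ℝ × grid S β n,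
      (jumpPath t a ⁻¹' {ω | ∀ j, ω.1 (τ j) = b j}).indicator (fun _ => (1 : ℂ)) w =
      ∑ ξ ∈ Fintype.piFinset fun _ : Fin N => grid S β n,
        (∏ j : Fin N, ((S.card : ℂ) ^ (2 * n))⁻¹ * (χ ((B j.succ - B j.castSucc) * ξ j) : ℂ)) *
          ∏ i, g ξ (w i) := by
    intro w
    have h1 : (jumpPath t a ⁻¹' {ω | ∀ j, ω.1 (τ j) = b j}).indicator (fun _ => (1 : ℂ)) w =
        ∏ j : Fin N, if ‖(B j.succ - B j.castSucc) -
          (jumpSum t a w (σ j.succ) - jumpSum t a w (σ j.castSucc))‖ ≤ ‖β‖ ^ (n : ℤ)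
          then (1 : ℂ) else 0 := by
      have hiff := hβ.jumpPath_eq_iff (τ := τ) hS ha w hb
      rw [Fintype.prod_boole]
      by_cases h : w ∈ jumpPath t a ⁻¹' {ω | ∀ j, ω.1 (τ j) = b j}
      · rw [if_pos (hiff.1 h), indicator_of_mem h]
      · rw [if_neg fun h' => h (hiff.2 h'), indicator_of_notMem h]
    have h2 : ∀ j : Fin N, (if ‖(B j.succ - B j.castSucc) -
          (jumpSum t a w (σ j.succ) - jumpSum t a w (σ j.castSucc))‖ ≤ ‖β‖ ^ (n : ℤ)
          then (1 : ℂ) else 0) = ∑ ξ ∈ grid S β n, ((S.card : ℂ) ^ (2 * n))⁻¹ *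
            (χ (((B j.succ - B j.castSucc) -
              (jumpSum t a w (σ j.succ) - jumpSum t a w (σ j.castSucc))) * ξ) : ℂ) := by
      intro j
      rw [← Finset.mul_sum, hχ.sum_grid hβ hS, mul_ite, inv_mul_cancel₀ hq, mul_zero]
      refine norm_sub_le_of_le ?_ (norm_sub_le_of_le (hβ.norm_jumpSum_le hS t ha w _)
        (hβ.norm_jumpSum_le hS t ha w _))
      rw [← hBs]
      exact hβ.norm_grid_sub_le hS ha hb j
    rw [h1, Finset.prod_congr rfl fun j _ => h2 j, Finset.prod_univ_sum]
    refine Finset.sum_congr rfl fun ξ _ => ?_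
    have h3 : ∏ i, g ξ (w i) = ∏ j : Fin N,
        (χ (-((jumpSum t a w (σ j.succ) - jumpSum t a w (σ j.castSucc)) * ξ j)) : ℂ) := by
      simp only [g]
      rw [Finset.prod_comm]
      refine Finset.prod_congr rfl fun j _ => ?_
      rw [jumpSum_sub t a w (hσ0 _) (hσm j.castSucc_lt_succ.le), Finset.sum_mul,
        ← Finset.sum_neg_distrib, map_addChar_sum]
      refine Finset.prod_congr rfl fun i _ => ?_
      split_ifs
      · rfl
      · simp
    rw [h3, ← Finset.prod_mul_distrib]
    refine Finset.prod_congr rfl fun j _ => ?_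
    rw [mul_assoc, ← Circle.coe_mul, ← AddChar.map_add_eq_mul, sub_mul, sub_eq_add_neg]
  have hint : ∀ ξ ∈ Fintype.piFinset fun _ : Fin N => grid S β n, Integrable (g ξ)
      (jumpIntensity S β χ α n t) ∧ ∫ w, g ξ w ∂(jumpIntensity S β χ α n t) =
      ((jumpRate β α n * t - ∑ j : Fin N, (σ j.succ - σ j.castSucc) * ‖ξ j‖ ^ α : ℝ) : ℂ) :=
    fun ξ hξ => hχ.integral_jumpIntensity hβ hS hα ht hσm hσ0 (cons_zero_le ht)
      (Fintype.mem_piFinset.1 hξ)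
  have hreal : (((Measure.pi fun _ : Fin m => jumpIntensity S β χ α n t).real
      (jumpPath t a ⁻¹' {ω | ∀ j, ω.1 (τ j) = b j}) : ℝ) : ℂ) =
      ∫ w, (jumpPath t a ⁻¹' {ω | ∀ j, ω.1 (τ j) = b j}).indicator (fun _ => (1 : ℂ)) w
        ∂(Measure.pi fun _ : Fin m => jumpIntensity S β χ α n t) := by
    rw [integral_indicator hmeas]
    simp
  rw [hreal, integral_congr_ae (Eventually.of_forall hpt), integral_finsetSum]
  · refine Finset.sum_congr rfl fun ξ hξ => ?_
    rw [integral_const_mul, integral_fintype_prod_eq_pow, (hint ξ hξ).2, Fintype.card_fin]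
    simp only [hσs, hBs]
  · exact fun ξ hξ => (Integrable.fintype_prod fun _ => (hint ξ hξ).1).const_mul _

/-- The Poisson weights sum the `m`-th powers to an exponential: `exp (-lam) ∑ (lam - y)^m / m! =
exp (-y)` with `y = ∑ δ_j ‖ξ_j‖^α`. This factors over `j`, and the sums over the `ξ_j` become the
densities. -/
lemma IsRankZeroCharacter.compoundPoisson_real_forall_eq (hβ : IsUniformizer β) (hS : IsDigitSet S)
    (hχ : IsRankZeroCharacter β χ) (hα : 0 < α) (ht : 0 < t) {a : K} (ha : a ∈ grid S β n)
    {N : ℕ} {τ : Fin N → Icc (0 : ℝ) t} (hτ : StrictMono τ) {b : Fin N → K}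
    (hb : ∀ j, b j ∈ grid S β n) :
    (compoundPoisson S β χ α n t a).real {ω | ∀ j, ω.1 (τ j) = b j} =
      ∏ j : Fin N, density S β χ α n
        ((τ j : ℝ) - (Fin.cons 0 (fun j => (τ j : ℝ)) : Fin (N + 1) → ℝ) j.castSucc)
        (b j - (Fin.cons a b : Fin (N + 1) → K) j.castSucc) * ((S.card : ℝ) ^ n)⁻¹ := by
  set δ : Fin N → ℝ := fun j =>
    (τ j : ℝ) - (Fin.cons 0 (fun j => (τ j : ℝ)) : Fin (N + 1) → ℝ) j.castSucc with hδ
  have hδ0 : ∀ j, 0 ≤ δ j := fun j => by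
    have := monotone_cons_zero hτ j.castSucc_lt_succ.le
    simpa [hδ] using this
  have hmeas : MeasurableSet {ω : SkorokhodSpace K t | ∀ j, ω.1 (τ j) = b j} :=
    measurableSet_forall_eval_mem τ (J := fun j => {b j}) fun j => measurableSet_singleton _
  set lam := jumpRate β α n * t
  have h1 : (compoundPoisson S β χ α n t a).real {ω | ∀ j, ω.1 (τ j) = b j} =
      ∑' m : ℕ, Real.exp (-lam) / m.factorial *
        (Measure.pi fun _ : Fin m => jumpIntensity S β χ α n t).real
          (jumpPath t a ⁻¹' {ω | ∀ j, ω.1 (τ j) = b j}) := by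
    rw [measureReal_def, compoundPoisson, Measure.sum_apply _ hmeas, ENNReal.tsum_toReal_eq]
    · refine tsum_congr fun m => ?_
      rw [Measure.smul_apply, Measure.map_apply (measurable_jumpPath hS t a) hmeas, smul_eq_mul,
        ENNReal.toReal_mul, ENNReal.toReal_ofReal (by positivity)]
      rfl
    · intro m
      rw [Measure.smul_apply, Measure.map_apply (measurable_jumpPath hS t a) hmeas, smul_eq_mul]
      exact ENNReal.mul_ne_top ENNReal.ofReal_ne_top (measure_ne_top _ _)
  have hexp : ∀ y : ℝ, HasSum (fun m : ℕ => ((Real.exp (-lam) / m.factorial : ℝ) : ℂ) *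
      ((lam - y : ℝ) : ℂ) ^ m) ((Real.exp (-y) : ℝ) : ℂ) := by
    intro y
    have h := (NormedSpace.expSeries_div_hasSum_exp (𝔸 := ℝ) (lam - y)).mul_left (Real.exp (-lam))
    rw [← Real.exp_eq_exp_ℝ, ← Real.exp_add] at h
    have h' := Complex.hasSum_ofReal.2 h
    convert h' using 1
    · ext m
      push_cast
      ring
    · congr 2
      ring
  have h2 : HasSum (fun m : ℕ => ((Real.exp (-lam) / m.factorial *
        (Measure.pi fun _ : Fin m => jumpIntensity S β χ α n t).real
          (jumpPath t a ⁻¹' {ω | ∀ j, ω.1 (τ j) = b j}) : ℝ) : ℂ))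
      (∑ ξ ∈ Fintype.piFinset fun _ : Fin N => grid S β n,
        (∏ j : Fin N, ((S.card : ℂ) ^ (2 * n))⁻¹ *
          (χ ((b j - (Fin.cons a b : Fin (N + 1) → K) j.castSucc) * ξ j) : ℂ)) *
        ((Real.exp (-∑ j, δ j * ‖ξ j‖ ^ α) : ℝ) : ℂ)) := by
    have h3 := hasSum_sum (s := Fintype.piFinset fun _ : Fin N => grid S β n) fun ξ _ =>
      (hexp (∑ j, δ j * ‖ξ j‖ ^ α)).mul_left
        (∏ j : Fin N, ((S.card : ℂ) ^ (2 * n))⁻¹ *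
          (χ ((b j - (Fin.cons a b : Fin (N + 1) → K) j.castSucc) * ξ j) : ℂ))
    refine Eq.mp (congrArg (fun f => HasSum f _) (funext fun m => ?_)) h3
    rw [Complex.ofReal_mul, hχ.pi_jumpIntensity_real hβ hS hα ht ha m hτ hb, Finset.mul_sum]
    exact Finset.sum_congr rfl fun ξ _ => mul_left_comm _ _ _
  have h4 : ∑ ξ ∈ Fintype.piFinset fun _ : Fin N => grid S β n,
        (∏ j : Fin N, ((S.card : ℂ) ^ (2 * n))⁻¹ *
          (χ ((b j - (Fin.cons a b : Fin (N + 1) → K) j.castSucc) * ξ j) : ℂ)) *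
        ((Real.exp (-∑ j, δ j * ‖ξ j‖ ^ α) : ℝ) : ℂ) =
      ((∏ j : Fin N, density S β χ α n (δ j)
        (b j - (Fin.cons a b : Fin (N + 1) → K) j.castSucc) * ((S.card : ℝ) ^ n)⁻¹ : ℝ) : ℂ) := by
    have h5 : ∀ j, ((density S β χ α n (δ j)
        (b j - (Fin.cons a b : Fin (N + 1) → K) j.castSucc) * ((S.card : ℝ) ^ n)⁻¹ : ℝ) : ℂ) =
        ∑ ξ ∈ grid S β n, ((S.card : ℂ) ^ (2 * n))⁻¹ *
          (χ ((b j - (Fin.cons a b : Fin (N + 1) → K) j.castSucc) * ξ) : ℂ) *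
          ((Real.exp (-δ j * ‖ξ‖ ^ α) : ℝ) : ℂ) := by
      intro j
      rw [Complex.ofReal_mul, hχ.ofReal_density hβ hS hα (hδ0 j) (hβ.norm_grid_sub_le hS ha hb j),
        finiteFourierInv, Finset.mul_sum, Finset.sum_mul]
      refine Finset.sum_congr rfl fun ξ _ => ?_
      rw [two_mul, pow_add]
      push_cast
      ring
    rw [Complex.ofReal_prod, Finset.prod_congr rfl fun j _ => h5 j, Finset.prod_univ_sum]
    refine Finset.sum_congr rfl fun ξ _ => ?_
    rw [Finset.prod_mul_distrib (g := fun j => ((Real.exp (-δ j * ‖ξ j‖ ^ α) : ℝ) : ℂ)),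
      ← Complex.ofReal_prod, ← Real.exp_sum]
    simp only [neg_mul, Finset.sum_neg_distrib]
  rw [h4, Complex.hasSum_ofReal] at h2
  rw [h1, h2.tsum_eq]

open Classical in
lemma IsRankZeroCharacter.isPathMeasure_compoundPoisson (hβ : IsUniformizer β) (hS : IsDigitSet S)
    (hχ : IsRankZeroCharacter β χ) (hα : 0 < α) (ht : 0 < t) {a : K} (ha : a ∈ grid S β n) :
    IsPathMeasure S β χ α n t a (compoundPoisson S β χ α n t a) := by
  have hprob : IsProbabilityMeasure (compoundPoisson S β χ α n t a) := by
    -- With no time constraints the formula is an empty product, so the total mass is 1.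
    have h := hχ.compoundPoisson_real_forall_eq hβ hS hα ht ha (N := 0)
      (τ := fun i => i.elim0) (fun i => i.elim0) (b := fun i => i.elim0) (fun i => i.elim0)
    simp only [IsEmpty.forall_iff, Finset.univ_eq_empty, Finset.prod_empty] at h
    refine ⟨?_⟩
    rw [measureReal_def, ENNReal.toReal_eq_one_iff] at h
    simpa using h
  refine ⟨hprob, fun N τ J hτ hJ => ?_⟩
  have hgrid : ∀ s : Icc (0 : ℝ) t, ∀ᵐ ω ∂(compoundPoisson S β χ α n t a), ω.1 s ∈ grid S β n := by
    intro s
    have hm : MeasurableSet {ω : SkorokhodSpace K t | ¬ ω.1 s ∈ grid S β n} :=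
      measurable_eval_skorokhod s (Finset.measurableSet _).compl
    rw [ae_iff, compoundPoisson, Measure.sum_apply _ hm, ENNReal.tsum_eq_zero]
    intro m
    rw [Measure.smul_apply, Measure.map_apply (measurable_jumpPath hS t a) hm]
    have he : (jumpPath t a : (Fin m → ℝ × grid S β n) → SkorokhodSpace K t) ⁻¹'
        {ω | ¬ ω.1 s ∈ grid S β n} = ∅ := by
      ext w
      simp only [mem_preimage, mem_ofPred_eq, mem_empty_iff_false, iff_false, not_not]
      exact (hβ.gridRep_spec hS (hβ.norm_jumpSum_le hS t ha w _)).1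
    rw [he, measure_empty, smul_zero]
  have hset : {ω : SkorokhodSpace K t | ∀ i, ω.1 (τ i) ∈ J i} =ᵐ[compoundPoisson S β χ α n t a]
      ⋃ b ∈ Fintype.piFinset (fun i => (grid S β n).filter (· ∈ J i)),
        {ω : SkorokhodSpace K t | ∀ i, ω.1 (τ i) = b i} := by
    filter_upwards [ae_all_iff.2 fun i => hgrid (τ i)] with ω hω
    refine propext (?_ : (∀ i, ω.1 (τ i) ∈ J i) ↔ ω ∈ ⋃ b ∈ _, _)
    simp only [mem_iUnion, mem_ofPred_eq, exists_prop]
    constructor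
    · intro h
      exact ⟨fun i => ω.1 (τ i), Fintype.mem_piFinset.2 fun i => Finset.mem_filter.2 ⟨hω i, h i⟩,
        fun i => rfl⟩
    · rintro ⟨b, hb, h⟩ i
      rw [h i]
      exact (Finset.mem_filter.1 (Fintype.mem_piFinset.1 hb i)).2
  rw [measureReal_congr hset, measureReal_biUnion_finset]
  · refine Finset.sum_congr rfl fun b hb => ?_
    exact hχ.compoundPoisson_real_forall_eq hβ hS hα ht ha hτ fun j =>
      (Finset.mem_filter.1 (Fintype.mem_piFinset.1 hb j)).1
  · intro b _ c _ hbc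
    refine Set.disjoint_left.2 fun ω h1 h2 => hbc (funext fun i => ?_)
    exact (h1 i).symm.trans (h2 i)
  · exact fun b _ => measurableSet_forall_eval_mem τ (J := fun j => {b j}) fun j =>
      measurableSet_singleton _

lemma IsRankZeroCharacter.existsUnique_isPathMeasure (hβ : IsUniformizer β) (hS : IsDigitSet S)
    (hχ : IsRankZeroCharacter β χ) (hα : 0 < α) (ht : 0 < t) {a : K} (ha : a ∈ grid S β n) :
    ∃! P : Measure (SkorokhodSpace K t), IsPathMeasure S β χ α n t a P :=
  ⟨_, hχ.isPathMeasure_compoundPoisson hβ hS hα ht ha, fun _ hP =>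
    hP.unique (hχ.isPathMeasure_compoundPoisson hβ hS hα ht ha)⟩

lemma IsRankZeroCharacter.isPathMeasure_pathMeasure (hβ : IsUniformizer β) (hS : IsDigitSet S)
    (hχ : IsRankZeroCharacter β χ) (hα : 0 < α) (ht : 0 < t) {a : K} (ha : a ∈ grid S β n) :
    IsPathMeasure S β χ α n t a (pathMeasure S β χ α n t a) :=
  Classical.epsilon_spec (hχ.existsUnique_isPathMeasure hβ hS hα ht ha).exists

end Existence

/-! ### Measurability and Jensen's inequality for integrals along paths. -/

section PathIntegrals

variable {K : Type*} [NontriviallyNormedField K] {t : ℝ}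

lemma IsSkorokhod.continuousWithinAt_Ici {ω : Icc (0 : ℝ) t → K} (hω : IsSkorokhod ω)
    (s : Icc (0 : ℝ) t) : ContinuousWithinAt ω (Ici s) s :=
  continuousWithinAt_Ioi_iff_Ici.1 (hω.right_cont s)

/-- One-sided limits bound `v ∘ ω` near every time, and compactness of `[0,t]` makes the bound
global. This gives the integrability needed for Jensen's inequality. -/
lemma IsSkorokhod.exists_forall_le {ω : Icc (0 : ℝ) t → K} (hω : IsSkorokhod ω) {v : K → ℝ}
    (hv : Continuous v) : ∃ M, ∀ s, v (ω s) ≤ M := by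
  have h : ∃ M, ∀ s ∈ (univ : Set (Icc (0 : ℝ) t)), v (ω s) ≤ M := by
    refine isCompact_univ.induction_on (p := fun T => ∃ M, ∀ s ∈ T, v (ω s) ≤ M) ⟨0, by simp⟩
      (fun T T' hT ⟨M, hM⟩ => ⟨M, fun s hs => hM s (hT hs)⟩) ?_ ?_
    · rintro T T' ⟨M, hM⟩ ⟨M', hM'⟩
      refine ⟨max M M', fun s hs => ?_⟩
      rcases hs with hs | hs
      · exact (hM s hs).trans (le_max_left _ _)
      · exact (hM' s hs).trans (le_max_right _ _)
    · intro s _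
      obtain ⟨l, hl⟩ := hω.left_lim s
      refine ⟨{u | v (ω u) ≤ max (v l) (v (ω s)) + 1}, ?_, _, fun u hu => hu⟩
      rw [nhdsWithin_univ, ← nhdsLT_sup_nhdsGE]
      refine ⟨?_, ?_⟩
      · have h1 : v l < max (v l) (v (ω s)) + 1 := by linarith [le_max_left (v l) (v (ω s))]
        exact (((hv.tendsto l).comp hl).eventually_lt_const h1).mono fun u hu => le_of_lt hu
      · have h1 : v (ω s) < max (v l) (v (ω s)) + 1 := by linarith [le_max_right (v l) (v (ω s))]
        exact (((hv.tendsto _).comp (hω.continuousWithinAt_Ici s)).eventually_lt_const h1).mono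
          fun u hu => le_of_lt hu
  obtain ⟨M, hM⟩ := h
  exact ⟨M, fun s => hM s (mem_univ s)⟩

/-- Approximation of a time from the right. -/
lemma tendsto_projIcc_floor (ht : 0 ≤ t) (s : Icc (0 : ℝ) t) :
    Tendsto (fun N : ℕ => projIcc 0 t ht ((⌊(s : ℝ) * (N + 1)⌋₊ + 1 : ℝ) / (N + 1))) atTop
      (𝓝[≥] s) := by
  -- The `+ 1` after the floor keeps the approximating times to the right of `s`, the side on which
  -- paths are continuous.
  have hlt : ∀ N : ℕ, (s : ℝ) ≤ (⌊(s : ℝ) * (N + 1)⌋₊ + 1 : ℝ) / (N + 1) := fun N => by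
    rw [le_div_iff₀ (by positivity)]
    exact (Nat.lt_floor_add_one _).le
  have hle : ∀ N : ℕ, (⌊(s : ℝ) * (N + 1)⌋₊ + 1 : ℝ) / (N + 1) ≤ s + 1 / ((N : ℝ) + 1) := fun N => by
    rw [div_le_iff₀ (by positivity), add_mul, one_div_mul_cancel (by positivity)]
    have := Nat.floor_le (mul_nonneg s.2.1 (by positivity : (0 : ℝ) ≤ (N : ℝ) + 1))
    linarith
  refine tendsto_nhdsWithin_iff.2 ⟨?_, Eventually.of_forall fun N => ?_⟩
  · have h1 : Tendsto (fun N : ℕ => (⌊(s : ℝ) * (N + 1)⌋₊ + 1 : ℝ) / (N + 1)) atTop (𝓝 (s : ℝ)) := by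
      refine tendsto_of_tendsto_of_tendsto_of_le_of_le tendsto_const_nhds ?_ hlt hle
      simpa using (tendsto_one_div_add_atTop_nhds_zero_nat (𝕜 := ℝ)).const_add (s : ℝ)
    simpa [Function.comp_def] using ((continuous_projIcc (h := ht)).tendsto (s : ℝ)).comp h1
  · have := monotone_projIcc ht (hlt N)
    simpa using this

variable [MeasurableSpace K] [BorelSpace K]

/-- Joint measurability of the evaluation of Skorokhod paths. -/
lemma measurable_comp_skorokhod {f : K → ℝ} (hf : Continuous f) (ht : 0 ≤ t) :
    Measurable fun p : SkorokhodSpace K t × ℝ => f (p.1.1 (projIcc 0 t ht p.2)) := by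
  refine measurable_of_tendsto_metrizable (f := fun (N : ℕ) (p : SkorokhodSpace K t × ℝ) =>
    f (p.1.1 (projIcc 0 t ht ((⌊(projIcc 0 t ht p.2 : ℝ) * (N + 1)⌋₊ + 1 : ℝ) / (N + 1))))) ?_ ?_
  · intro N
    -- The discretised time takes countably many values, so joint measurability reduces to that of
    -- single coordinates.
    have h1 : Measurable fun q : SkorokhodSpace K t × ℕ =>
        f (q.1.1 (projIcc 0 t ht ((q.2 + 1 : ℝ) / (N + 1)))) :=
      measurable_from_prod_countable_left fun k =>
        hf.measurable.comp (measurable_eval_skorokhod (projIcc 0 t ht ((k + 1 : ℝ) / (N + 1))))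
    have h2 : Measurable fun p : SkorokhodSpace K t × ℝ =>
        (p.1, ⌊(projIcc 0 t ht p.2 : ℝ) * (N + 1)⌋₊) := by
      refine measurable_fst.prodMk (Nat.measurable_floor.comp ?_)
      exact ((continuous_subtype_val.comp continuous_projIcc).measurable.comp
        measurable_snd).mul_const _
    exact h1.comp h2
  · rw [tendsto_pi_nhds]
    intro p
    exact (hf.tendsto _).comp ((p.1.2.continuousWithinAt_Ici _).tendsto.comp
      (tendsto_projIcc_floor ht _))

lemma measurable_exp_neg_integral {v : K → ℝ} (hv : Continuous v) (ht : 0 ≤ t) :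
    Measurable fun ω : SkorokhodSpace K t =>
      Real.exp (-∫ s in (0 : ℝ)..t, v (ω.1 (projIcc 0 t ht s))) := by
  simp_rw [intervalIntegral.integral_of_le ht]
  refine Real.measurable_exp.comp (Measurable.neg ?_)
  exact ((measurable_comp_skorokhod hv ht).stronglyMeasurable.integral_prod_right
    (ν := volume.restrict (Ioc 0 t))).measurable

/-- Jensen's inequality along a path. -/
lemma exp_neg_integral_le {v : K → ℝ} (hv : Continuous v) (hv0 : ∀ x, 0 ≤ v x) (ht : 0 < t)
    (ω : SkorokhodSpace K t) :
    Real.exp (-∫ s in (0 : ℝ)..t, v (ω.1 (projIcc 0 t ht.le s))) ≤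
      t⁻¹ * ∫ s in Ioo 0 t, Real.exp (-t * v (ω.1 (projIcc 0 t ht.le s))) := by
  have hm : Measurable fun s : ℝ => v (ω.1 (projIcc 0 t ht.le s)) :=
    (measurable_comp_skorokhod hv ht.le).comp measurable_prodMk_left
  obtain ⟨M, hM⟩ := ω.2.exists_forall_le hv
  have hvol : volume.real (Ioo 0 t) = t := by simp [Real.volume_real_Ioo_of_le ht.le]
  have hi : IntegrableOn (fun s : ℝ => -t * v (ω.1 (projIcc 0 t ht.le s))) (Ioo 0 t) volume := by
    refine Integrable.const_mul (Integrable.of_bound (C := M) hm.aestronglyMeasurable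
      (Eventually.of_forall fun s => ?_)) _
    rw [Real.norm_of_nonneg (hv0 _)]
    exact hM _
  have hi2 : IntegrableOn (Real.exp ∘ fun s : ℝ => -t * v (ω.1 (projIcc 0 t ht.le s))) (Ioo 0 t)
      volume := by
    refine Integrable.of_bound (C := 1)
      (Real.measurable_exp.comp (hm.const_mul _)).aestronglyMeasurable
      (Eventually.of_forall fun s => ?_)
    rw [Function.comp_apply, Real.norm_of_nonneg (Real.exp_pos _).le, Real.exp_le_one_iff]
    nlinarith [hv0 (ω.1 (projIcc 0 t ht.le s))]
  -- The average of `-t v(ω(s))` over `(0,t)` is exactly `-∫ v(ω(s)) ds`.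
  have h := convexOn_exp.map_set_average_le Real.continuous_exp.continuousOn isClosed_univ
    (by simp [ht]) (by simp) (by simp) hi hi2
  rw [setAverage_eq, setAverage_eq, hvol, smul_eq_mul, smul_eq_mul, integral_const_mul] at h
  rw [intervalIntegral.integral_of_le ht.le, integral_Ioc_eq_integral_Ioo]
  convert h using 2
  field_simp

end PathIntegrals

/-! ### Bounds for the propagator on the diagonal. -/

section Estimate

variable {K : Type*} [NontriviallyNormedField K]

lemma sphereInf_le {v : K → ℝ} (hv0 : ∀ x, 0 ≤ v x) {x y : K} (h : ‖y‖ = ‖x‖) :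
    sphereInf v x ≤ v y :=
  csInf_le ⟨0, by rintro _ ⟨z, -, rfl⟩; exact hv0 z⟩ ⟨y, h, rfl⟩

lemma sphereInf_nonneg {v : K → ℝ} (hv0 : ∀ x, 0 ≤ v x) (x : K) : 0 ≤ sphereInf v x :=
  Real.sInf_nonneg (by rintro _ ⟨z, -, rfl⟩; exact hv0 z)

lemma norm_eq_of_norm_sub_lt [IsUltrametricDist K] {x y : K} (h : ‖y - x‖ < ‖x‖) : ‖y‖ = ‖x‖ := by
  refine le_antisymm (by simpa using norm_add_le_of_le h.le le_rfl) ?_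
  by_contra! h1
  have := norm_sub_le_of_le (le_max_left ‖y‖ ‖y - x‖) (le_max_right ‖y‖ ‖y - x‖)
  rw [sub_sub_cancel] at this
  exact absurd this (not_le.2 (max_lt h1 h))

variable [MeasurableSpace K] [BorelSpace K] {β : K} {S : Finset K} {χ : AddChar K Circle} {α : ℝ}
  {n : ℕ} {t : ℝ}

lemma measurableSet_not_norm_sub_le (x : K) (c : ℝ) : MeasurableSet {y : K | ¬ ‖y - x‖ ≤ c} := by
  have h : IsClosed {y : K | ‖y - x‖ ≤ c} := isClosed_le (by fun_prop) continuous_const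
  exact h.measurableSet.compl

lemma IsPathMeasure.real_eval_eq {a : K} {P : Measure (SkorokhodSpace K t)}
    (hP : IsPathMeasure S β χ α n t a P) (s : Icc (0 : ℝ) t) {x : K} (hx : x ∈ grid S β n) :
    P.real {ω | ω.1 s = x} = density S β χ α n s (x - a) * ((S.card : ℝ) ^ n)⁻¹ := by
  classical
  have h := hP.2 1 (fun _ => s) (fun _ => {x}) (Subsingleton.strictMono _)
    (fun _ => measurableSet_singleton x)
  have hset : {ω : SkorokhodSpace K t | ∀ _ : Fin 1, ω.1 s ∈ ({x} : Set K)} = {ω | ω.1 s = x} := by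
    ext ω
    simp
  rw [hset] at h
  rw [h, Finset.sum_eq_single (fun _ => x)]
  · simp
  · intro b hb hne
    exact absurd (funext fun i => (Finset.mem_filter.1 (Fintype.mem_piFinset.1 hb i)).2) hne
  · intro hb
    refine absurd (Fintype.mem_piFinset.2 fun i => ?_) hb
    exact Finset.mem_filter.2 ⟨hx, mem_singleton x⟩

lemma IsPathMeasure.real_eval_mem_eval_eq {a : K} {P : Measure (SkorokhodSpace K t)}
    (hP : IsPathMeasure S β χ α n t a P) {s s' : Icc (0 : ℝ) t} (hs : s < s') {J : Set K}
    [DecidablePred (· ∈ J)] (hJ : MeasurableSet J) {x : K} (hx : x ∈ grid S β n) :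
    P.real {ω | ω.1 s ∈ J ∧ ω.1 s' = x} = ∑ y ∈ grid S β n with y ∈ J,
      density S β χ α n s (y - a) * ((S.card : ℝ) ^ n)⁻¹ *
        (density S β χ α n (s' - s) (x - y) * ((S.card : ℝ) ^ n)⁻¹) := by
  have h := hP.2 2 ![s, s'] ![J, {x}] ?_ ?_
  · have hset : {ω : SkorokhodSpace K t | ∀ i : Fin 2, ω.1 (![s, s'] i) ∈ (![J, {x}] : Fin 2 → Set K) i} =
        {ω | ω.1 s ∈ J ∧ ω.1 s' = x} := by
      ext ω
      simp [Fin.forall_fin_two]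
    rw [hset] at h
    rw [h]
    refine Finset.sum_nbij' (fun b => b 0) (fun y => ![y, x]) ?_ ?_ ?_ ?_ ?_
    · intro b hb
      exact Finset.mem_filter.2 ((@Finset.mem_filter K _ (_) _ _).1 (Fintype.mem_piFinset.1 hb 0))
    · intro y hy
      have hy' := Finset.mem_filter.1 hy
      rw [Fintype.mem_piFinset, Fin.forall_fin_two]
      exact ⟨(@Finset.mem_filter K _ (_) _ _).2 hy', (@Finset.mem_filter K _ (_) _ _).2 ⟨hx, mem_singleton x⟩⟩
    · intro b hb
      ext i
      fin_cases i
      · rfl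
      · exact ((@Finset.mem_filter K _ (_) _ _).1 (Fintype.mem_piFinset.1 hb 1)).2.symm
    · intro y _
      rfl
    · intro b hb
      have h1 : b 1 = x := ((@Finset.mem_filter K _ (_) _ _).1 (Fintype.mem_piFinset.1 hb 1)).2
      have e0 : Fin.castSucc (0 : Fin 2) = 0 := rfl
      have e1 : Fin.castSucc (1 : Fin 2) = Fin.succ 0 := rfl
      rw [Fin.prod_univ_two, h1, e0, e1]
      simp only [Fin.cons_zero, Fin.cons_succ, Matrix.cons_val_zero, Matrix.cons_val_one, sub_zero]
  · intro i j hij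
    fin_cases i <;> fin_cases j <;> simp_all
  · simpa [Fin.forall_fin_two] using hJ

variable [IsUltrametricDist K]

/-- The normalisation of the conditioned measure, `p_t(0) q⁻ⁿ`, cancels the density factor of the
propagator and leaves `qⁿ`. -/
lemma IsRankZeroCharacter.propagator_self_eq (hβ : IsUniformizer β) (hS : IsDigitSet S)
    (hχ : IsRankZeroCharacter β χ) (hα : 0 < α) (ht : 0 < t) (v : K → ℝ) {x : K}
    (hx : x ∈ grid S β n) :
    propagator S β χ α v n ht x x = (S.card : ℝ) ^ n *
      ∫ ω in {ω : SkorokhodSpace K t | ω.1 ⟨t, ht.le, le_rfl⟩ = x},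
        Real.exp (-∫ s in (0 : ℝ)..t, v (ω.1 (projIcc 0 t ht.le s)))
        ∂(pathMeasure S β χ α n t x) := by
  have h := (hχ.isPathMeasure_pathMeasure hβ hS hα ht hx).real_eval_eq ⟨t, ht.le, le_rfl⟩ hx
  rw [sub_self] at h
  have hp : 0 < density S β χ α n t 0 := density_zero_pos hS
  have hq : (0 : ℝ) < (S.card : ℝ) ^ n := pow_pos (by exact_mod_cast hS.card_pos) n
  rw [propagator, bridgeMeasure, ProbabilityTheory.cond, integral_smul_measure, ENNReal.toReal_inv,
    ← measureReal_def, h, sub_self, smul_eq_mul]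
  field_simp

/-- A bound on the mass of loops which are far from their starting point at an intermediate
time. -/
lemma IsRankZeroCharacter.pathMeasure_far_le (hβ : IsUniformizer β) (hS : IsDigitSet S)
    (hχ : IsRankZeroCharacter β χ) (hα : 0 < α) (ht : 0 < t) {C : ℝ}
    (hC : density S β χ α n (t / 2) 0 ≤ C) {r : ℤ} (hr : -(n : ℤ) ≤ r) (hrn : r ≤ n) {x : K}
    (hx : x ∈ grid S β n) {s : Icc (0 : ℝ) t} (hs : (s : ℝ) < t) :
    (S.card : ℝ) ^ n * (pathMeasure S β χ α n t x).real
      {ω | ω.1 s ∈ {y | ¬ ‖y - x‖ ≤ ‖β‖ ^ (-r)} ∧ ω.1 ⟨t, ht.le, le_rfl⟩ = x} ≤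
      C * (t * (‖β‖ ^ r) ^ α) := by
  classical
  have hq : (0 : ℝ) < (S.card : ℝ) ^ n := pow_pos (by exact_mod_cast hS.card_pos) n
  have hxn := hβ.norm_le_of_mem_grid hS hx
  have hC0 : 0 < C := (density_zero_pos hS).trans_le hC
  have hJ : MeasurableSet {y : K | ¬ ‖y - x‖ ≤ ‖β‖ ^ (-r)} :=
    measurableSet_not_norm_sub_le x _
  rw [(hχ.isPathMeasure_pathMeasure hβ hS hα ht hx).real_eval_mem_eval_eq
    (s' := ⟨t, ht.le, le_rfl⟩) (Subtype.mk_lt_mk.2 hs) hJ hx]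
  -- The density at the longer time `w ≥ t/2` is bounded by `C`; the one at time `u` is summed by
  -- the tail estimate.
  have key : ∀ u w : ℝ, 0 ≤ u → u ≤ t → t / 2 ≤ w →
      ∑ y ∈ grid S β n with ¬ ‖y - x‖ ≤ ‖β‖ ^ (-r),
        density S β χ α n u (y - x) * density S β χ α n w (y - x) ≤
      (S.card : ℝ) ^ n * (C * (t * (‖β‖ ^ r) ^ α)) := by
    intro u w hu hut hw
    calc _ ≤ ∑ y ∈ grid S β n with ¬ ‖y - x‖ ≤ ‖β‖ ^ (-r), density S β χ α n u (y - x) * C := by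
          refine Finset.sum_le_sum fun y hy => mul_le_mul_of_nonneg_left ?_ ?_
          · exact (density_le_density_zero _).trans ((density_zero_anti hw).trans hC)
          · exact hχ.density_nonneg hβ hS hα hu (norm_sub_le_of_le
              (hβ.norm_le_of_mem_grid hS (Finset.mem_filter.1 hy).1) hxn)
      _ ≤ ((S.card : ℝ) ^ n * (u * (‖β‖ ^ r) ^ α)) * C := by
          rw [← Finset.sum_mul]
          exact mul_le_mul_of_nonneg_right (hχ.sum_density_tail_le hβ hS hα hu hr hrn hxn) hC0.le
      _ ≤ ((S.card : ℝ) ^ n * (t * (‖β‖ ^ r) ^ α)) * C := by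
          gcongr
      _ = _ := by ring
  have hsum : ∑ y ∈ grid S β n with y ∈ {y : K | ¬ ‖y - x‖ ≤ ‖β‖ ^ (-r)},
      density S β χ α n s (y - x) * ((S.card : ℝ) ^ n)⁻¹ *
        (density S β χ α n (t - s) (x - y) * ((S.card : ℝ) ^ n)⁻¹) =
      ((S.card : ℝ) ^ n)⁻¹ * ((S.card : ℝ) ^ n)⁻¹ *
        ∑ y ∈ grid S β n with ¬ ‖y - x‖ ≤ ‖β‖ ^ (-r),
          density S β χ α n s (y - x) * density S β χ α n (t - s) (y - x) := by
    rw [Finset.mul_sum]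
    refine Finset.sum_congr (Finset.filter_congr fun y _ => Iff.rfl) fun y _ => ?_
    rw [← neg_sub y x, density_neg]
    ring
  have hfin : ∑ y ∈ grid S β n with ¬ ‖y - x‖ ≤ ‖β‖ ^ (-r),
      density S β χ α n s (y - x) * density S β χ α n (t - s) (y - x) ≤
      (S.card : ℝ) ^ n * (C * (t * (‖β‖ ^ r) ^ α)) := by
    rcases le_total (s : ℝ) (t / 2) with h | h
    · exact key s (t - s) s.2.1 s.2.2 (by linarith)
    · simp_rw [mul_comm (density S β χ α n (s : ℝ) _)]
      exact key (t - s) s (by linarith) (by linarith [s.2.1]) h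
  dsimp only
  rw [hsum, mul_assoc, mul_inv_cancel_left₀ hq.ne']
  rwa [inv_mul_le_iff₀ hq]

lemma IsRankZeroCharacter.propagator_self_le_density (hβ : IsUniformizer β) (hS : IsDigitSet S)
    (hχ : IsRankZeroCharacter β χ) (hα : 0 < α) (ht : 0 < t) {v : K → ℝ} (hv : Continuous v)
    (hv0 : ∀ x, 0 ≤ v x) {x : K} (hx : x ∈ grid S β n) :
    propagator S β χ α v n ht x x ≤ density S β χ α n t 0 := by
  have hP := hχ.isPathMeasure_pathMeasure hβ hS hα ht hx
  have := hP.1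
  have h := hP.real_eval_eq ⟨t, ht.le, le_rfl⟩ hx
  rw [sub_self] at h
  have hq : (0 : ℝ) < (S.card : ℝ) ^ n := pow_pos (by exact_mod_cast hS.card_pos) n
  rw [hχ.propagator_self_eq hβ hS hα ht v hx]
  have hb : ∀ ω : SkorokhodSpace K t,
      Real.exp (-∫ s in (0 : ℝ)..t, v (ω.1 (projIcc 0 t ht.le s))) ≤ 1 := fun ω => by
    rw [Real.exp_le_one_iff, neg_nonpos]
    exact intervalIntegral.integral_nonneg ht.le fun s _ => hv0 _
  have h1 : ∫ ω in {ω : SkorokhodSpace K t | ω.1 ⟨t, ht.le, le_rfl⟩ = x},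
      Real.exp (-∫ s in (0 : ℝ)..t, v (ω.1 (projIcc 0 t ht.le s))) ∂(pathMeasure S β χ α n t x) ≤
      ∫ ω in {ω : SkorokhodSpace K t | ω.1 ⟨t, ht.le, le_rfl⟩ = x}, (1 : ℝ)
        ∂(pathMeasure S β χ α n t x) := by
    refine integral_mono ?_ (integrable_const _) hb
    refine Integrable.of_bound (C := 1) (measurable_exp_neg_integral hv ht.le).aestronglyMeasurable
      (Eventually.of_forall fun ω => ?_)
    rw [Real.norm_of_nonneg (Real.exp_pos _).le]
    exact hb ω
  rw [integral_const, smul_eq_mul, mul_one, measureReal_restrict_apply_univ, h] at h1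
  calc _ ≤ (S.card : ℝ) ^ n * (density S β χ α n t 0 * ((S.card : ℝ) ^ n)⁻¹) := by gcongr
    _ = _ := by field_simp

/-- Jensen and Fubini reduce the bound to `hinner` at a single time. There, paths within `‖β‖ ^ (-r)
< ‖x‖` of `x` stay on the sphere through `x` and contribute the exponential, while
`pathMeasure_far_le` controls the others. -/
lemma IsRankZeroCharacter.propagator_self_le (hβ : IsUniformizer β) (hS : IsDigitSet S)
    (hχ : IsRankZeroCharacter β χ) (hα : 0 < α) (ht : 0 < t) {v : K → ℝ} (hv : Continuous v)
    (hv0 : ∀ x, 0 ≤ v x) {C : ℝ} (hC : density S β χ α n (t / 2) 0 ≤ C) {x : K}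
    (hx : x ∈ grid S β n) {r : ℤ} (hr : -(n : ℤ) ≤ r) (hrn : r ≤ n) (hrx : ‖β‖ ^ (-r) < ‖x‖) :
    propagator S β χ α v n ht x x ≤
      C * (Real.exp (-t * sphereInf v x) + t * (‖β‖ ^ r) ^ α) := by
  have hP := hχ.isPathMeasure_pathMeasure hβ hS hα ht hx
  have := hP.1
  have hq : (0 : ℝ) < (S.card : ℝ) ^ n := pow_pos (by exact_mod_cast hS.card_pos) n
  set P := pathMeasure S β χ α n t x
  set E : Set (SkorokhodSpace K t) := {ω | ω.1 ⟨t, ht.le, le_rfl⟩ = x}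
  have hPE : P.real E = density S β χ α n t 0 * ((S.card : ℝ) ^ n)⁻¹ := by
    have h := hP.real_eval_eq ⟨t, ht.le, le_rfl⟩ hx
    rwa [sub_self] at h
  set J : Set K := {y | ¬ ‖y - x‖ ≤ ‖β‖ ^ (-r)}
  have hJ : MeasurableSet J :=
    measurableSet_not_norm_sub_le x _
  set D : ℝ := C * (Real.exp (-t * sphereInf v x) + t * (‖β‖ ^ r) ^ α) with hD
  let F : SkorokhodSpace K t × ℝ → ℝ := fun p => Real.exp (-t * v (p.1.1 (projIcc 0 t ht.le p.2)))
  have hFm : Measurable F := measurable_comp_skorokhod (f := fun y => Real.exp (-t * v y))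
    (by fun_prop) ht.le
  have hF1 : ∀ p, F p ≤ 1 := fun p => by
    rw [Real.exp_le_one_iff]
    nlinarith [hv0 (p.1.1 (projIcc 0 t ht.le p.2))]
  have hFn : ∀ p, ‖F p‖ ≤ 1 := fun p => by
    rw [Real.norm_of_nonneg (Real.exp_pos _).le]
    exact hF1 p
  have hFi : Integrable F ((P.restrict E).prod (volume.restrict (Ioo 0 t))) :=
    Integrable.of_bound (C := 1) hFm.aestronglyMeasurable (Eventually.of_forall hFn)
  -- The open interval matters: the two-time distribution needs `s` strictly before `t`.
  have hinner : ∀ s ∈ Ioo 0 t, ∫ ω in E, F (ω, s) ∂P ≤ ((S.card : ℝ) ^ n)⁻¹ * D := by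
    intro s hs
    set s' : Icc (0 : ℝ) t := projIcc 0 t ht.le s with hs'
    have hs't : (s' : ℝ) < t := by
      rw [hs', projIcc_of_mem ht.le ⟨hs.1.le, hs.2.le⟩]
      exact hs.2
    have hpre : MeasurableSet {ω : SkorokhodSpace K t | ω.1 s' ∈ J} := measurable_eval_skorokhod s' hJ
    have hpt : ∀ ω : SkorokhodSpace K t, F (ω, s) ≤ Real.exp (-t * sphereInf v x) +
        {ω : SkorokhodSpace K t | ω.1 s' ∈ J}.indicator (fun _ => (1 : ℝ)) ω := by
      intro ω
      by_cases hω : ω ∈ {ω : SkorokhodSpace K t | ω.1 s' ∈ J}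
      · rw [indicator_of_mem hω]
        exact (hF1 _).trans (by linarith [Real.exp_pos (-t * sphereInf v x)])
      · rw [indicator_of_notMem hω, add_zero, Real.exp_le_exp]
        have h1 : ‖ω.1 s' - x‖ ≤ ‖β‖ ^ (-r) := not_not.1 hω
        have h2 := sphereInf_le hv0 (norm_eq_of_norm_sub_lt (h1.trans_lt hrx))
        show -t * v (ω.1 s') ≤ _
        nlinarith
    have h3 : ∫ ω in E, F (ω, s) ∂P ≤ ∫ ω in E, (Real.exp (-t * sphereInf v x) +
        {ω : SkorokhodSpace K t | ω.1 s' ∈ J}.indicator (fun _ => (1 : ℝ)) ω) ∂P := by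
      refine integral_mono ?_ ?_ hpt
      · exact Integrable.of_bound (C := 1) (hFm.comp measurable_prodMk_right).aestronglyMeasurable
          (Eventually.of_forall fun ω => hFn _)
      · exact (integrable_const _).add ((integrable_const _).indicator hpre)
    rw [integral_add (integrable_const _) ((integrable_const _).indicator hpre),
      integral_indicator hpre, integral_const, integral_const, measureReal_restrict_apply_univ,
      measureReal_restrict_apply_univ, measureReal_restrict_apply hpre, smul_eq_mul, smul_eq_mul,
      mul_one, hPE] at h3
    have h4 : (S.card : ℝ) ^ n * P.real ({ω : SkorokhodSpace K t | ω.1 s' ∈ J} ∩ E) ≤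
        C * (t * (‖β‖ ^ r) ^ α) := hχ.pathMeasure_far_le hβ hS hα ht hC hr hrn hx hs't
    have h5 : density S β χ α n t 0 ≤ C := (density_zero_anti (by linarith)).trans hC
    refine h3.trans ?_
    rw [inv_mul_eq_div, le_div_iff₀ hq, add_mul, hD, mul_add]
    refine add_le_add ?_ (by linarith)
    rw [mul_right_comm, inv_mul_cancel_right₀ hq.ne']
    gcongr
  have hfub : ∫ ω in E, Real.exp (-∫ s in (0 : ℝ)..t, v (ω.1 (projIcc 0 t ht.le s))) ∂P ≤
      ((S.card : ℝ) ^ n)⁻¹ * D := by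
    calc _ ≤ ∫ ω in E, (t⁻¹ * ∫ s in Ioo 0 t, F (ω, s)) ∂P := by
          refine integral_mono ?_ (hFi.integral_prod_left.const_mul _)
            (exp_neg_integral_le hv hv0 ht)
          refine Integrable.of_bound (C := 1)
            (measurable_exp_neg_integral hv ht.le).aestronglyMeasurable
            (Eventually.of_forall fun ω => ?_)
          rw [Real.norm_of_nonneg (Real.exp_pos _).le, Real.exp_le_one_iff, neg_nonpos]
          exact intervalIntegral.integral_nonneg ht.le fun s _ => hv0 _
      _ = t⁻¹ * ∫ s in Ioo 0 t, (∫ ω in E, F (ω, s) ∂P) := by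
          rw [integral_const_mul, integral_integral_swap hFi]
      _ ≤ t⁻¹ * ∫ s in Ioo 0 t, ((S.card : ℝ) ^ n)⁻¹ * D := by
          refine mul_le_mul_of_nonneg_left ?_ (by positivity)
          exact setIntegral_mono_on hFi.integral_prod_right (integrable_const _) measurableSet_Ioo
            hinner
      _ = ((S.card : ℝ) ^ n)⁻¹ * D := by
          rw [integral_const, measureReal_restrict_apply_univ, Real.volume_real_Ioo_of_le ht.le,
            sub_zero, smul_eq_mul, inv_mul_cancel_left₀ ht.ne']
  rw [hχ.propagator_self_eq hβ hS hα ht v hx]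
  calc _ ≤ (S.card : ℝ) ^ n * (((S.card : ℝ) ^ n)⁻¹ * D) := by gcongr
    _ = D := mul_inv_cancel_left₀ hq.ne' _

end Estimate

end LocalFieldPropagator

end

/-! ### The theorem: choice of the radius and of the constant. -/

open LocalFieldPropagator in
theorem mainTheorem9 {K : Type*} [NontriviallyNormedField K] [IsUltrametricDist K]
    [LocallyCompactSpace K] [MeasurableSpace K] [BorelSpace K]
    (hK : IsCanonicalAbs K)
    (β : K) (hβ : IsUniformizer β)
    (S : Finset K) (hS : IsDigitSet S)
    (χ : AddChar K Circle) (hχ : IsRankZeroCharacter β χ)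
    (α : ℝ) (hα : 0 < α)
    (v : K → ℝ) (hv : Continuous v) (hv0 : ∀ x, 0 ≤ v x)
    (hvlim : Filter.Tendsto v (Bornology.cobounded K) Filter.atTop)
    (t : ℝ) (ht : 0 < t) :
    (∀ n : ℕ, 0 < n → ∀ a ∈ grid S β n,
      ∃! P : MeasureTheory.Measure (SkorokhodSpace K t), IsPathMeasure S β χ α n t a P) ∧
    ∀ k : ℝ, 0 < k → k < α →
      ∃ A : ℝ, 0 < A ∧ ∀ n : ℕ, 0 < n → ∀ x ∈ grid S β n, x ≠ 0 →
        propagator S β χ α v n ht x x ≤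
          A * (Real.exp (-(t / 2) * sphereInf v x) + 1 / ‖x‖ ^ k) := by
  refine ⟨fun n _ a ha => hχ.existsUnique_isPathMeasure hβ hS hα ht ha, fun k hk hkα => ?_⟩
  obtain ⟨C, hC⟩ := hχ.exists_density_zero_le hβ hS hα (half_pos ht)
  have hC0 : 0 < C := (density_zero_pos hS).trans_le (hC 0)
  have hp := hβ.norm_pos
  have hb0 : 0 < ‖β‖ ^ (-α) := Real.rpow_pos_of_pos hp _
  -- `C` bounds `p_{t/2,n}(0)` for every `n`; the factor `‖β‖ ^ (-α)` is the cost of taking a radius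
  -- one step below `‖x‖`.
  refine ⟨C * (1 + t * ‖β‖ ^ (-α)), by positivity, fun n hn x hx hx0 => ?_⟩
  have hxp : 0 < ‖x‖ := norm_pos_iff.2 hx0
  have hk0 : 0 < ‖x‖ ^ k := Real.rpow_pos_of_pos hxp k
  have he := Real.exp_pos (-(t / 2) * sphereInf v x)
  rcases lt_or_ge ‖x‖ 1 with hlt | hge
  · have h1 : 1 ≤ 1 / ‖x‖ ^ k := by
      rw [le_div_iff₀ hk0, one_mul]
      exact Real.rpow_le_one hxp.le hlt.le hk.le
    calc propagator S β χ α v n ht x x ≤ density S β χ α n t 0 :=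
          hχ.propagator_self_le_density hβ hS hα ht hv hv0 hx
      _ ≤ C * 1 * 1 := by
          rw [mul_one, mul_one]
          exact (density_zero_anti (by linarith)).trans (hC n)
      _ ≤ _ := by
          have : (0 : ℝ) ≤ t * ‖β‖ ^ (-α) := by positivity
          gcongr <;> linarith
  · obtain ⟨j, hj⟩ := hβ.exists_norm_eq hx0
    have hj0 : 0 ≤ j := by
      rw [hj, ← zpow_zero ‖β‖, ← neg_zero, hβ.zpow_le_zpow_iff] at hge
      exact hge
    have hjn : j ≤ n := by
      have := hβ.norm_le_of_mem_grid hS hx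
      rwa [hj, hβ.zpow_le_zpow_iff] at this
    have hrx : ‖β‖ ^ (-(j - 1)) < ‖x‖ := by
      rw [hj]
      exact zpow_lt_zpow_right_of_lt_one₀ hp hβ.norm_lt_one (by omega)
    -- With `‖x‖ = ‖β‖ ^ (-j)`, the index `j - 1` gives the largest radius below `‖x‖`; `j ≥ 0` and
    -- `n ≥ 1` ensure `-n ≤ j - 1`.
    have h1 := hχ.propagator_self_le hβ hS hα ht hv hv0 (hC n) hx (r := j - 1) (by omega)
      (by omega) hrx
    have h2 : (‖β‖ ^ (j - 1)) ^ α = ‖β‖ ^ (-α) * (1 / ‖x‖ ^ α) := by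
      have h3 : ‖β‖ ^ (j - 1) = ‖β‖⁻¹ * ‖x‖⁻¹ := by
        rw [hj, zpow_neg, inv_inv, zpow_sub_one₀ hp.ne', mul_comm]
      rw [h3, Real.mul_rpow (by positivity) (by positivity), Real.inv_rpow hp.le,
        Real.inv_rpow hxp.le, Real.rpow_neg hp.le, one_div]
    -- Here `‖x‖ ≥ 1` allows the exponent `α` to be lowered to `k`.
    have h4 : 1 / ‖x‖ ^ α ≤ 1 / ‖x‖ ^ k :=
      one_div_le_one_div_of_le hk0 (Real.rpow_le_rpow_of_exponent_le hge hkα.le)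
    have h5 : Real.exp (-t * sphereInf v x) ≤ Real.exp (-(t / 2) * sphereInf v x) := by
      rw [Real.exp_le_exp]
      nlinarith [sphereInf_nonneg hv0 x]
    refine h1.trans ?_
    rw [h2, mul_assoc]
    refine mul_le_mul_of_nonneg_left ?_ hC0.le
    have h6 : t * (‖β‖ ^ (-α) * (1 / ‖x‖ ^ α)) ≤ t * ‖β‖ ^ (-α) * (1 / ‖x‖ ^ k) := by
      rw [← mul_assoc]
      gcongr
    have h7 : 0 ≤ t * ‖β‖ ^ (-α) * Real.exp (-(t / 2) * sphereInf v x) := by positivity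
    have h8 : 0 < 1 / ‖x‖ ^ k := by positivity
    nlinarith
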